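/- Let $\operatorname{erf}(z)=\frac{2}{\sqrt\pi}\int_0^z e^{-t^2}\,dt$. For $v\in\mathbb R^K$ and $U\in\mathbb R^{K\times d}$ with rows $u_1,\dots,u_K\in\mathbb R^d$, the binary single-hidden-erf-layer (SHEL) network is $$F_{U,v}(x)=\sum_{k=1}^K v_k\,\operatorname{erf}\!\left(\frac{u_k\cdot x}{\sqrt2\,\|x\|_2}\right)\quad(x\in\mathbb R^d),\qquad F_{U,v}(0):=0 .$$ Let $\mathcal D$ be a probability distribution on $\mathbb R^d\times\{+1,-1\}$. For $F:\mathbb R^d\to\mathbb R$ put $L(F)=\Pr_{(x,y)\sim\mathcal D}\{yF(x)\le 0\}$ and, for a sample $S\in(\mathbb R^d\times\{+1,-1\})^m$, $\hat L_\gamma(F)=m^{-1}|\{(x,y)\in S: yF(x)<\gamma\}|$ (counted with multiplicity). Let $\operatorname{kl}(q:p)=q\log\frac qp+(1-q)\log\frac{1-q}{1-p}$ if $p\ge q$, and $\operatorname{kl}(q:p)=0$ otherwise. For $v\neq0$ let $p_k=|v_k|/\|v\|_1$ and $H[p]=-\sum_k p_k\log p_k$. **Theorem.** There is an absolute constant $C>0$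 such that the following holds. Fix $m\ge1$, a distribution $\mathcal D$, prior parameters $U^0\in\mathbb R^{K\times d}$ with rows $u_1^0,\dots,u_K^0$, a margin $\gamma>0$ and $\delta\in(0,1)$. With probability at least $1-\delta$ over $S\sim\mathcal D^m$, simultaneously for all $v\in\mathbb R^K$ and $U\in\mathbb R^{K\times d}$, the network $F=F_{U,v}$ satisfies $$L(F)\le\hat L_\gamma(F)+C\sqrt{\frac{\|v\|_1\log(2m)}{m\gamma^2}\sum_{k=1}^K|v_k|\left(\|u_k-u_k^0\|_2^2+\log(2K)\right)+\frac{\log(1/\delta)}{m}},$$ that is, $L(F)\le\hat L_\gamma(F)+\tilde O\Big(\sqrt{\tfrac{\|v\|_1}{m\gamma^2}\sum_k|v_k|\|u_k-u_k^0\|_2^2}\Big)$ where $\tilde O$ hides factors logarithmic in $m$, the addition of $\log(2K)$ to each squared distance, and the confidence term $\log(1/\delta)/m$; and, whenever $\gamma\le\|v\|_1$, the tighter bound $$\operatorname{kl}\!\left(\hat L_\gamma(F)+\tfrac1m : L(F)-\tfrac1m\right)\le\frac{32(\|v\|_1/\gamma)^2\log m+1}{m}\left(\log 2K-H[p]+\frac12\sum_{k=1}^K\frac{|v_k|}{\|v\|_1}\|u_k-u_k^0\|_2^2\right)+\frac{\log\frac2\delta+2\log\log_2(4\|v\|_1/\gamma)}{m}.$$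 -/

import Mathlib

open MeasureTheory

noncomputable section

namespace SHEL

/-- The error function, `erf z = (2 / √π) ∫₀ᶻ exp (-t²) dt`. -/
def erf (z : ℝ) : ℝ :=
  2 / Real.sqrt Real.pi * ∫ t in (0 : ℝ)..z, Real.exp (-t ^ 2)

/-- Input space `ℝᵈ` with its Euclidean norm. -/
abbrev Input (d : ℕ) : Type := EuclideanSpace ℝ (Fin d)

/-- Binary labels `{+1, -1}`. -/
abbrev Label : Type := {y : ℝ // y = 1 ∨ y = -1}

/-- The binary single-hidden-erf-layer network with output weights `v` and hidden units
`u 1, …, u K` (the rows of the hidden weight matrix):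
`x ↦ ∑ k, v k * erf (⟨u k, x⟩ / (√2 ‖x‖))`. At `x = 0` its value is `0`. -/
def network {K d : ℕ} (v : Fin K → ℝ) (u : Fin K → Input d) (x : Input d) : ℝ :=
  ∑ k, v k * erf (inner ℝ (u k) x / (Real.sqrt 2 * ‖x‖))

/-- The binary margin `y * f x` of a predictor `f` at the example `(x, y)`. -/
def margin {d : ℕ} (f : Input d → ℝ) (z : Input d × Label) : ℝ :=
  (z.2 : ℝ) * f z.1

/-- The margin error `P(margin ≤ γ)` under the data distribution. -/
def marginError {d : ℕ} (D : Measure (Input d × Label)) (γ : ℝ) (f : Input d → ℝ) : ℝ :=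
  D.real {z | margin f z ≤ γ}

/-- The misclassification probability: the margin error at margin `0`. -/
def error {d : ℕ} (D : Measure (Input d × Label)) (f : Input d → ℝ) : ℝ :=
  marginError D 0 f

open Classical in
/-- The empirical margin error: the fraction of the sample with margin `< γ`. -/
def empMarginError {d m : ℕ} (S : Fin m → Input d × Label) (γ : ℝ) (f : Input d → ℝ) : ℝ :=
  ((Finset.univ.filter fun i => margin f (S i) < γ).card : ℝ) / m

/-- The one-sided binary Kullback-Leibler divergence `kl(q : p)`: the divergence of a
Bernoulli(`q`) from a Bernoulli(`p`) variable if `q ≤ p`, and `0` otherwise.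
(It is used only at arguments for which `q ≤ p` implies `0 < q ≤ p < 1`.) -/
def klOneSided (q p : ℝ) : ℝ :=
  if q ≤ p then q * Real.log (q / p) + (1 - q) * Real.log ((1 - q) / (1 - p)) else 0

/-- The `ℓ¹` norm of the output weights. -/
def l1Norm {K : ℕ} (v : Fin K → ℝ) : ℝ := ∑ k, |v k|

/-- The normalised absolute output weights `|v k| / ‖v‖₁`. -/
def mixWeight {K : ℕ} (v : Fin K → ℝ) (k : Fin K) : ℝ := |v k| / l1Norm v

/-- Shannon entropy (natural logarithm) `-∑ k, p k * log (p k)`. -/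
def entropy {K : ℕ} (p : Fin K → ℝ) : ℝ := ∑ k, Real.negMulLog (p k)

/-- The complexity
`log (2K) - H[p] + ½ ∑ k, p k * ‖u k - u⁰ k‖²` with `p k = |v k| / ‖v‖₁`. -/
def complexity {K d : ℕ} (v : Fin K → ℝ) (u u₀ : Fin K → Input d) : ℝ :=
  Real.log (2 * K) - entropy (mixWeight v) + 1 / 2 * ∑ k, mixWeight v k * ‖u k - u₀ k‖ ^ 2

end SHEL

end

noncomputable section

namespace SHEL

open ProbabilityTheory
open scoped ENNReal

/-! The network is a majority vote. For `w` Gaussian with mean `u k` and identity covariance, `erf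
(⟨u k, x⟩ / (√2 ‖x‖))` is the mean of `sign ⟨w, x⟩`. Hence the margin divided by `l1Norm v` is the
mean, under the posterior, of the margin of one random signed unit: pick `k` with probability `|v k|
/ l1Norm v`, give it the sign of `v k`, and draw `w` around `u k` (`integral_unitMargin`). Against
the prior, uniform over the `2K` signed indices with `w` drawn around `u₀ k`, the relative entropy
is bounded by `complexity` (`changeOfMeasure_posterior_prior`).

To pass from randomised predictors to the network, average `T ≈ 2 n² log m` independent units. By
Hoeffding, the averaged margin is within `1 / n` of its mean on the relevant side, except with
probability `1 / m`. The event "averaged margin at most `1 / n`" therefore lies between the true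
error and the empirical error at normalised margin `θ ≥ 2 / n`, up to `1 / m` on each side.
PAC-Bayes-kl is applied to this event with the `T`-fold product posterior, which costs `T * c`. A
union bound over `n` allows the margin to depend on the sample.

PAC-Bayes-kl itself rests on one sample statistic, the inverse binomial likelihood. Its mean is at
most `m + 1`, and it dominates every exponential tilt at once, so the tilt may be chosen after the
sample and the posterior. The square-root form follows from the kl form by a Pinsker-type
inequality. -/

/-! ### Change of measure: densities, products, Gaussians, mixtures -/

/-- The Donsker–Varadhan change-of-measure inequality with constant `c`, for bounded measurable
functions. It holds with `c` the Kullback-Leibler divergence of `Q` from `P`. -/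
def ChangeOfMeasure {Ω : Type*} [MeasurableSpace Ω] (Q P : Measure Ω) (c : ℝ) : Prop :=
  ∀ f : Ω → ℝ, Measurable f → (∃ B, ∀ ω, |f ω| ≤ B) →
    ∫ ω, f ω ∂Q ≤ c + Real.log (∫ ω, Real.exp (f ω) ∂P)

lemma integrable_of_abs_le {Ω : Type*} [MeasurableSpace Ω] {μ : Measure Ω} [IsFiniteMeasure μ]
    {f : Ω → ℝ} (hf : Measurable f) {B : ℝ} (hB : ∀ ω, |f ω| ≤ B) : Integrable f μ :=
  Integrable.of_bound hf.aestronglyMeasurable B (ae_of_all _ hB)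

lemma integrable_exp_of_abs_le {Ω : Type*} [MeasurableSpace Ω] {μ : Measure Ω}
    [IsFiniteMeasure μ] {f : Ω → ℝ} (hf : Measurable f) {B : ℝ} (hB : ∀ ω, |f ω| ≤ B) :
    Integrable (fun ω => Real.exp (f ω)) μ :=
  Integrable.of_bound hf.exp.aestronglyMeasurable (Real.exp B) (ae_of_all _ fun ω => by
    rw [Real.norm_eq_abs, Real.abs_exp]
    exact Real.exp_le_exp.2 (abs_le.1 (hB ω)).2)

lemma integral_exp_pos_of_abs_le {Ω : Type*} [MeasurableSpace Ω] {μ : Measure Ω}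
    [IsProbabilityMeasure μ] {f : Ω → ℝ} (hf : Measurable f) {B : ℝ} (hB : ∀ ω, |f ω| ≤ B) :
    0 < ∫ ω, Real.exp (f ω) ∂μ :=
  integral_exp_pos (integrable_exp_of_abs_le hf hB)

lemma abs_log_integral_exp_le {Ω : Type*} [MeasurableSpace Ω] {μ : Measure Ω}
    [IsProbabilityMeasure μ] {f : Ω → ℝ} (hf : Measurable f) {B : ℝ} (hB : ∀ ω, |f ω| ≤ B) :
    |Real.log (∫ ω, Real.exp (f ω) ∂μ)| ≤ B := by
  have hpos := integral_exp_pos_of_abs_le (μ := μ) hf hB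
  have hi := integrable_exp_of_abs_le (μ := μ) hf hB
  rw [abs_le]
  constructor
  · rw [Real.le_log_iff_exp_le hpos]
    have := integral_mono (μ := μ) (integrable_const (Real.exp (-B))) hi
      (fun ω => Real.exp_le_exp.2 (abs_le.1 (hB ω)).1)
    simpa using this
  · rw [Real.log_le_iff_le_exp hpos]
    have := integral_mono (μ := μ) hi (integrable_const (Real.exp B))
      (fun ω => Real.exp_le_exp.2 (abs_le.1 (hB ω)).2)
    simpa using this

/-- Jensen's inequality for `exp` applied to `f - ℓ` under `Q`; the density cancels `exp (-ℓ)`,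
leaving the integral of `exp f` under `P`. -/
lemma ChangeOfMeasure.of_withDensity {Ω : Type*} [MeasurableSpace Ω] {Q P : Measure Ω}
    [IsProbabilityMeasure Q] [IsProbabilityMeasure P] {ℓ : Ω → ℝ} (hℓ : Measurable ℓ)
    (hQ : Q = P.withDensity fun ω => ENNReal.ofReal (Real.exp (ℓ ω))) (hint : Integrable ℓ Q) :
    ChangeOfMeasure Q P (∫ ω, ℓ ω ∂Q) := by
  rintro f hf ⟨B, hB⟩
  have hfQ : Integrable f Q := integrable_of_abs_le hf hB
  have hd : Measurable fun ω => ENNReal.ofReal (Real.exp (ℓ ω)) := hℓ.exp.ennreal_ofReal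
  have hmul : ∀ ω, (ENNReal.ofReal (Real.exp (ℓ ω))).toReal • Real.exp (f ω - ℓ ω) =
      Real.exp (f ω) := fun ω => by
    rw [ENNReal.toReal_ofReal (Real.exp_pos _).le, smul_eq_mul, ← Real.exp_add]
    congr 1; ring
  have hiQ : Integrable (fun ω => Real.exp (f ω - ℓ ω)) Q := by
    rw [hQ, integrable_withDensity_iff_integrable_smul' hd (by simp)]
    simp_rw [hmul]
    exact integrable_exp_of_abs_le hf hB
  have heq : ∫ ω, Real.exp (f ω - ℓ ω) ∂Q = ∫ ω, Real.exp (f ω) ∂P := by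
    rw [hQ, integral_withDensity_eq_integral_toReal_smul hd (by simp)]
    simp_rw [hmul]
  have hJ := convexOn_exp.map_integral_le (μ := Q) (f := fun ω => f ω - ℓ ω)
    Real.continuous_exp.continuousOn isClosed_univ (by simp) (hfQ.sub hint) hiQ
  rw [heq] at hJ
  have := (Real.le_log_iff_exp_le (integral_exp_pos_of_abs_le hf hB)).2 hJ
  rw [integral_sub hfQ hint] at this
  linarith

/-- The log-integral of `exp f` over the second coordinate is again bounded and measurable in the
first, so the two inequalities can be chained and the constants add. -/
lemma ChangeOfMeasure.prod {α β : Type*} [MeasurableSpace α] [MeasurableSpace β]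
    {Q₁ P₁ : Measure α} {Q₂ P₂ : Measure β} [IsProbabilityMeasure Q₁] [IsProbabilityMeasure P₁]
    [IsProbabilityMeasure Q₂] [IsProbabilityMeasure P₂] {c₁ c₂ : ℝ}
    (h₁ : ChangeOfMeasure Q₁ P₁ c₁) (h₂ : ChangeOfMeasure Q₂ P₂ c₂) :
    ChangeOfMeasure (Q₁.prod Q₂) (P₁.prod P₂) (c₁ + c₂) := by
  rintro f hf ⟨B, hB⟩
  have hfx : ∀ x, Measurable fun y => f (x, y) := fun x => by fun_prop
  have hgm : Measurable fun x => Real.log (∫ y, Real.exp (f (x, y)) ∂P₂) :=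
    (hf.exp.stronglyMeasurable.integral_prod_right).measurable.log
  have hgB : ∀ x, |Real.log (∫ y, Real.exp (f (x, y)) ∂P₂)| ≤ B := fun x =>
    abs_log_integral_exp_le (hfx x) fun y => hB _
  have hfi : Integrable f (Q₁.prod Q₂) := integrable_of_abs_le hf hB
  have hgi : Integrable (fun x => Real.log (∫ y, Real.exp (f (x, y)) ∂P₂)) Q₁ :=
    integrable_of_abs_le hgm hgB
  calc ∫ z, f z ∂Q₁.prod Q₂ = ∫ x, ∫ y, f (x, y) ∂Q₂ ∂Q₁ := integral_prod _ hfi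
    _ ≤ ∫ x, (c₂ + Real.log (∫ y, Real.exp (f (x, y)) ∂P₂)) ∂Q₁ :=
        integral_mono hfi.integral_prod_left ((integrable_const _).add hgi)
          fun x => h₂ _ (hfx x) ⟨B, fun y => hB _⟩
    _ = c₂ + ∫ x, Real.log (∫ y, Real.exp (f (x, y)) ∂P₂) ∂Q₁ := by
        rw [integral_add (integrable_const _) hgi]; simp
    _ ≤ c₂ + (c₁ + Real.log
          (∫ x, Real.exp (Real.log (∫ y, Real.exp (f (x, y)) ∂P₂)) ∂P₁)) := by
        gcongr
        exact h₁ _ hgm ⟨B, hgB⟩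
    _ = c₁ + c₂ + Real.log (∫ z, Real.exp (f z) ∂P₁.prod P₂) := by
        rw [integral_prod _ (integrable_exp_of_abs_le hf hB)]
        simp_rw [fun x => Real.exp_log
          (integral_exp_pos_of_abs_le (μ := P₂) (hfx x) fun y => hB (x, y))]
        ring

lemma ChangeOfMeasure.of_measurePreserving {α β : Type*} [MeasurableSpace α] [MeasurableSpace β]
    {Q P : Measure α} {Q' P' : Measure β} {c : ℝ} (e : α ≃ᵐ β) (hQ : MeasurePreserving e Q Q')
    (hP : MeasurePreserving e P P') (h : ChangeOfMeasure Q' P' c) : ChangeOfMeasure Q P c := by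
  rintro f hf ⟨B, hB⟩
  have := h (fun y => f (e.symm y)) (hf.comp e.symm.measurable) ⟨B, fun y => hB _⟩
  rw [← hQ.integral_comp' (fun y => f (e.symm y)),
    ← hP.integral_comp' (fun y => Real.exp (f (e.symm y)))] at this
  simpa using this

lemma ChangeOfMeasure.pi {α : Type*} [MeasurableSpace α] {n : ℕ} {Q P : Fin n → Measure α}
    [∀ i, IsProbabilityMeasure (Q i)] [∀ i, IsProbabilityMeasure (P i)] {c : Fin n → ℝ}
    (h : ∀ i, ChangeOfMeasure (Q i) (P i) (c i)) :
    ChangeOfMeasure (Measure.pi Q) (Measure.pi P) (∑ i, c i) := by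
  induction n with
  | zero =>
    rintro f hf ⟨B, hB⟩
    have hc : ∀ x, f x = f default := fun x => congrArg f (Subsingleton.elim _ _)
    simp [hc]
  | succ n ih =>
    rw [Fin.sum_univ_succAbove _ 0]
    exact ChangeOfMeasure.of_measurePreserving (MeasurableEquiv.piFinSuccAbove (fun _ => α) 0)
      (measurePreserving_piFinSuccAbove Q 0) (measurePreserving_piFinSuccAbove P 0)
      ((h 0).prod (ih fun i => h _))

lemma changeOfMeasure_gaussianReal (a b : ℝ) :
    ChangeOfMeasure (gaussianReal a 1) (gaussianReal b 1) ((a - b) ^ 2 / 2) := by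
  have hid : Integrable (fun x : ℝ => x) (gaussianReal a 1) :=
    (memLp_id_gaussianReal 1).integrable le_rfl
  -- The integrand is the log-density of `N(a, 1)` with respect to `N(b, 1)`.
  have hint : Integrable (fun x => (a - b) * x - (a ^ 2 - b ^ 2) / 2) (gaussianReal a 1) :=
    (hid.const_mul _).sub (integrable_const _)
  have hval : ∫ x, ((a - b) * x - (a ^ 2 - b ^ 2) / 2) ∂gaussianReal a 1 = (a - b) ^ 2 / 2 := by
    rw [integral_sub (hid.const_mul _) (integrable_const _), integral_const_mul,
      integral_id_gaussianReal]
    simp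
    ring
  rw [← hval]
  refine ChangeOfMeasure.of_withDensity (by fun_prop) ?_ hint
  rw [gaussianReal_of_var_ne_zero a one_ne_zero, gaussianReal_of_var_ne_zero b one_ne_zero,
    ← withDensity_mul _ (measurable_gaussianPDF _ _) (by fun_prop)]
  congr 1
  ext x
  simp only [gaussianPDF, gaussianPDFReal, Pi.mul_apply]
  rw [← ENNReal.ofReal_mul (by positivity), mul_assoc (_)⁻¹, ← Real.exp_add]
  congr 3
  simp
  ring

/-- The law of a pair `(j, ω)` with `j` drawn with probabilities `q` and `ω` drawn from `μ j`. -/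
def mixture {ι Ω : Type*} [Fintype ι] [MeasurableSpace ι] [MeasurableSpace Ω] (q : ι → ℝ)
    (μ : ι → Measure Ω) : Measure (ι × Ω) :=
  ∑ j, ENNReal.ofReal (q j) • (μ j).map (Prod.mk j)

lemma isProbabilityMeasure_mixture {ι Ω : Type*} [Fintype ι] [MeasurableSpace ι]
    [MeasurableSpace Ω] {q : ι → ℝ} (hq : ∀ j, 0 ≤ q j) (hq1 : ∑ j, q j = 1) (μ : ι → Measure Ω)
    [∀ j, IsProbabilityMeasure (μ j)] : IsProbabilityMeasure (mixture q μ) := by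
  constructor
  have : ∀ j, (μ j).map (Prod.mk j) Set.univ = 1 := fun j => by
    rw [Measure.map_apply measurable_prodMk_left MeasurableSet.univ]; simp
  simp [mixture, this, ← ENNReal.ofReal_sum_of_nonneg fun j _ => hq j, hq1]

lemma integral_mixture {ι Ω : Type*} [Fintype ι] [MeasurableSpace ι] [MeasurableSpace Ω]
    {q : ι → ℝ} (hq : ∀ j, 0 ≤ q j) (μ : ι → Measure Ω) [∀ j, IsProbabilityMeasure (μ j)]
    {f : ι × Ω → ℝ} (hf : Measurable f) {B : ℝ} (hB : ∀ z, |f z| ≤ B) :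
    ∫ z, f z ∂mixture q μ = ∑ j, q j * ∫ ω, f (j, ω) ∂μ j := by
  rw [mixture, integral_finsetSum_measure]
  · refine Finset.sum_congr rfl fun j _ => ?_
    rw [integral_smul_measure, ENNReal.toReal_ofReal (hq j), smul_eq_mul,
      integral_map measurable_prodMk_left.aemeasurable hf.aestronglyMeasurable]
  · intro j _
    have : IsProbabilityMeasure ((μ j).map (Prod.mk j)) :=
      Measure.isProbabilityMeasure_map measurable_prodMk_left.aemeasurable
    exact (integrable_of_abs_le hf hB).smul_measure ENNReal.ofReal_ne_top

/-- After the componentwise inequality this is the Gibbs inequality: use `log s ≤ s - 1` at the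
ratio of the tilted prior weight `r j * A j / Z` to `q j`. The error terms cancel on summing, since
both families of weights sum to one. Indices with `q j = 0` are allowed because the posterior
charges only one sign per unit. -/
lemma ChangeOfMeasure.mixture {ι Ω : Type*} [Fintype ι] [Nonempty ι] [MeasurableSpace ι]
    [MeasurableSpace Ω] {q r : ι → ℝ} (hq : ∀ j, 0 ≤ q j) (hq1 : ∑ j, q j = 1)
    (hr : ∀ j, 0 < r j) {Q P : ι → Measure Ω} [∀ j, IsProbabilityMeasure (Q j)]
    [∀ j, IsProbabilityMeasure (P j)] {c : ι → ℝ} (h : ∀ j, ChangeOfMeasure (Q j) (P j) (c j)) :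
    ChangeOfMeasure (SHEL.mixture q Q) (SHEL.mixture r P)
      (∑ j, q j * (Real.log (q j / r j) + c j)) := by
  rintro f hf ⟨B, hB⟩
  have hfj : ∀ j, Measurable fun ω => f (j, ω) := fun j => by fun_prop
  set A : ι → ℝ := fun j => ∫ ω, Real.exp (f (j, ω)) ∂P j with hA
  have hApos : ∀ j, 0 < A j := fun j => integral_exp_pos_of_abs_le (hfj j) fun ω => hB _
  have hexpB : ∀ z, |Real.exp (f z)| ≤ Real.exp B := fun z => by
    rw [Real.abs_exp]; exact Real.exp_le_exp.2 (abs_le.1 (hB z)).2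
  rw [integral_mixture hq Q hf hB, integral_mixture (fun j => (hr j).le) P hf.exp hexpB]
  set Z : ℝ := ∑ j, r j * A j with hZ
  have hZpos : 0 < Z := Finset.sum_pos (fun j _ => mul_pos (hr j) (hApos j)) Finset.univ_nonempty
  have key : ∀ j, q j * ∫ ω, f (j, ω) ∂Q j ≤
      q j * (Real.log (q j / r j) + c j) + q j * Real.log Z + (r j * A j / Z - q j) := fun j => by
    have h1 := mul_le_mul_of_nonneg_left (h j _ (hfj j) ⟨B, fun ω => hB _⟩) (hq j)
    rcases (hq j).eq_or_lt with h0 | h0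
    · rw [← h0]
      have := mul_pos (hr j) (hApos j)
      simp only [zero_mul, zero_add, sub_zero]
      positivity
    · have h2 := Real.log_le_sub_one_of_pos (x := r j * A j / (q j * Z))
        (div_pos (mul_pos (hr j) (hApos j)) (mul_pos h0 hZpos))
      rw [Real.log_div (mul_pos (hr j) (hApos j)).ne' (mul_pos h0 hZpos).ne',
        Real.log_mul (hr j).ne' (hApos j).ne', Real.log_mul h0.ne' hZpos.ne'] at h2
      have h3 := mul_le_mul_of_nonneg_left h2 h0.le
      have h4 : q j * (r j * A j / (q j * Z) - 1) = r j * A j / Z - q j := by field_simp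
      rw [h4] at h3
      rw [Real.log_div h0.ne' (hr j).ne']
      nlinarith
  calc ∑ j, q j * ∫ ω, f (j, ω) ∂Q j
      ≤ ∑ j, (q j * (Real.log (q j / r j) + c j) + q j * Real.log Z + (r j * A j / Z - q j)) :=
        Finset.sum_le_sum fun j _ => key j
    _ = ∑ j, q j * (Real.log (q j / r j) + c j) + Real.log Z := by
        rw [Finset.sum_add_distrib, Finset.sum_add_distrib, Finset.sum_sub_distrib,
          ← Finset.sum_mul, ← Finset.sum_div, hq1, ← hZ, div_self hZpos.ne']
        ring

/-! ### The inverse binomial likelihood of the hit count -/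

section BinomialLikelihood

variable {X : Type*} {m : ℕ}

open Classical in
/-- The number of sample points lying in `A`. -/
def hitCount (A : Set X) (S : Fin m → X) : ℕ := (Finset.univ.filter fun i => S i ∈ A).card

lemma hitCount_le (A : Set X) (S : Fin m → X) : hitCount A S ≤ m := by
  classical
  exact (Finset.card_filter_le _ _).trans (by simp)

lemma hitCount_eq_sum (A : Set X) (S : Fin m → X) :
    (hitCount A S : ℝ) = ∑ i, A.indicator 1 (S i) := by
  classical
  simp [hitCount, Set.indicator_apply]

variable [MeasurableSpace X]

/-- The inverse of the binomial likelihood of the number of sample points in `A`. -/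
def invLikelihood (D : Measure X) (A : Set X) (S : Fin m → X) : ℝ≥0∞ :=
  (m.choose (hitCount A S) * (D A ^ hitCount A S * D Aᶜ ^ (m - hitCount A S)))⁻¹

/-- The expectation of one over the probability of the observed count is the number of counts of
positive probability. Here the sample space is split into the cylinders on which exactly the indices
in `B` hit `A`. -/
lemma lintegral_invLikelihood_le (D : Measure X) [IsProbabilityMeasure D] {A : Set X}
    (hA : MeasurableSet A) :
    ∫⁻ S : Fin m → X, invLikelihood D A S ∂Measure.pi (fun _ => D) ≤ m + 1 := by
  classical
  set w : ℕ → ℝ≥0∞ := fun k => D A ^ k * D Aᶜ ^ (m - k) with hw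
  set cyl : Finset (Fin m) → Set (Fin m → X) :=
    fun B => Set.pi Set.univ fun i => if i ∈ B then A else Aᶜ with hcyl
  have hcylm : ∀ B, MeasurableSet (cyl B) := fun B =>
    MeasurableSet.univ_pi fun i => by split_ifs <;> [exact hA; exact hA.compl]
  have hmem : ∀ B S, S ∈ cyl B ↔ B = Finset.univ.filter fun i => S i ∈ A := by
    intro B S
    simp only [hcyl, Set.mem_univ_pi, Finset.ext_iff, Finset.mem_filter, Finset.mem_univ, true_and]
    refine forall_congr' fun i => ?_
    by_cases hi : i ∈ B <;> simp [hi]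
  have hcylD : ∀ B, Measure.pi (fun _ : Fin m => D) (cyl B) = w B.card := fun B => by
    rw [hcyl, Measure.pi_pi]
    simp only [apply_ite D, hw]
    rw [Finset.prod_ite]
    simp only [Finset.prod_const, Finset.filter_not, Finset.filter_mem_eq_inter,
      Finset.univ_inter]
    rw [← Finset.compl_eq_univ_sdiff, Finset.card_compl, Fintype.card_fin]
  have hdecomp : ∀ S : Fin m → X, invLikelihood D A S =
      ∑ B, (cyl B).indicator (fun _ => ((m.choose B.card : ℝ≥0∞) * w B.card)⁻¹) S := fun S => by
    simp only [Set.indicator_apply, hmem]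
    rw [Finset.sum_ite_eq' Finset.univ]
    simp [invLikelihood, hitCount, hw]
  simp_rw [hdecomp]
  rw [lintegral_finsetSum _ fun B _ => measurable_const.indicator (hcylm B)]
  calc ∑ B, ∫⁻ S, (cyl B).indicator (fun _ => ((m.choose B.card : ℝ≥0∞) * w B.card)⁻¹) S
        ∂Measure.pi (fun _ : Fin m => D)
      ≤ ∑ B : Finset (Fin m), (m.choose B.card : ℝ≥0∞)⁻¹ := Finset.sum_le_sum fun B _ => by
        have hc : (m.choose B.card : ℝ≥0∞) ≠ 0 := by
          have := Nat.choose_pos (n := m) (k := B.card) (by simpa using B.card_le_univ)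
          exact_mod_cast this.ne'
        rw [lintegral_indicator_const (hcylm B), hcylD,
          ENNReal.mul_inv (Or.inl hc) (Or.inl (ENNReal.natCast_ne_top _)), mul_assoc]
        -- Only an inequality is available: if `w` vanishes its inverse is `∞`, but the cylinder is
        -- then null.
        exact mul_le_of_le_one_right' (ENNReal.inv_mul_le_one _)
    _ = ∑ k ∈ Finset.range (m + 1), m.choose k • (m.choose k : ℝ≥0∞)⁻¹ := by
        have := Finset.sum_powerset_apply_card (x := (Finset.univ : Finset (Fin m)))
          (fun k => (m.choose k : ℝ≥0∞)⁻¹)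
        simpa using this
    _ = m + 1 := by
        rw [Finset.sum_congr rfl fun k hk => ?_, Finset.sum_const, Finset.card_range, nsmul_one]
        · push_cast; rfl
        · rw [nsmul_eq_mul]
          refine ENNReal.mul_inv_cancel ?_ (ENNReal.natCast_ne_top _)
          have := Nat.choose_pos (Nat.lt_succ_iff.1 (Finset.mem_range.1 hk))
          exact_mod_cast this.ne'

/-- With `p` the mass of `A`, a single term of the binomial expansion of `(p * t + (1 - p)) ^ m` is
at most the whole. The right side is free of `t`, so the bound is uniform over tilts. -/
lemma ofReal_exp_le_invLikelihood (D : Measure X) [IsProbabilityMeasure D] {A : Set X}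
    (hA : MeasurableSet A) (S : Fin m → X) {t : ℝ} (ht : 0 < t) :
    ENNReal.ofReal (Real.exp (hitCount A S * Real.log t -
      m * Real.log (1 - D.real A * (1 - t)))) ≤ invLikelihood D A S := by
  set k := hitCount A S with hk
  have hkm : k ≤ m := hitCount_le A S
  set p := D.real A with hp
  have hp0 : 0 ≤ p := measureReal_nonneg
  have hp1 : p ≤ 1 := measureReal_le_one
  have hy : 0 < 1 - p * (1 - t) := by
    rcases hp1.eq_or_lt with h | h
    · rw [h]; linarith
    · nlinarith [mul_nonneg hp0 ht.le]
  have hDA : D A = ENNReal.ofReal p := by simp [hp]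
  have hDAc : D Aᶜ = ENNReal.ofReal (1 - p) := by
    rw [hp, ← probReal_compl_eq_one_sub hA]; simp
  rw [invLikelihood, ← hk, hDA, hDAc, ENNReal.le_inv_iff_mul_le, ← ENNReal.ofReal_pow hp0,
    ← ENNReal.ofReal_pow (by linarith), ← ENNReal.ofReal_natCast,
    ← ENNReal.ofReal_mul (by positivity), ← ENNReal.ofReal_mul (by positivity),
    ← ENNReal.ofReal_mul (by positivity), ENNReal.ofReal_le_one]
  rw [Real.exp_sub, ← Real.log_pow, ← Real.log_pow, Real.exp_log (by positivity),
    Real.exp_log (by positivity), div_mul_eq_mul_div, div_le_one (by positivity)]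
  have hbin := add_pow (p * t) (1 - p) m
  rw [show p * t + (1 - p) = 1 - p * (1 - t) by ring] at hbin
  rw [hbin]
  refine le_trans (le_of_eq ?_) (Finset.single_le_sum (f := fun j =>
    (p * t) ^ j * (1 - p) ^ (m - j) * (m.choose j : ℝ)) (fun j _ => ?_)
    (Finset.mem_range.2 (Nat.lt_succ_of_le hkm)))
  · rw [mul_pow]; ring
  · have : 0 ≤ 1 - p := by linarith
    positivity

end BinomialLikelihood

/-! ### PAC-Bayes-kl and Hoeffding's inequality -/

section PACBayes

variable {X H : Type*} [MeasurableSpace X] [MeasurableSpace H] {m : ℕ}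

lemma measurable_hitCount {A : Set (H × X)} (hA : MeasurableSet A) :
    Measurable fun z : (Fin m → X) × H => hitCount (Prod.mk z.2 ⁻¹' A) z.1 := by
  classical
  simp only [hitCount, Finset.card_filter]
  refine Finset.measurable_sum _ fun i _ => Measurable.ite ?_ measurable_const measurable_const
  exact (show Measurable fun z : (Fin m → X) × H => (z.2, z.1 i) by fun_prop) hA

lemma measurable_invLikelihood (D : Measure X) [IsProbabilityMeasure D] {A : Set (H × X)}
    (hA : MeasurableSet A) :
    Measurable fun z : (Fin m → X) × H => invLikelihood D (Prod.mk z.2 ⁻¹' A) z.1 := by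
  have h1 : Measurable fun z : (Fin m → X) × H => D (Prod.mk z.2 ⁻¹' A) :=
    (measurable_measure_prodMk_left hA).comp measurable_snd
  have h2 : Measurable fun z : (Fin m → X) × H => D (Prod.mk z.2 ⁻¹' A)ᶜ :=
    (measurable_measure_prodMk_left hA.compl).comp measurable_snd
  have hk := measurable_hitCount (m := m) hA
  have hc : Measurable fun z : (Fin m → X) × H =>
      (m.choose (hitCount (Prod.mk z.2 ⁻¹' A) z.1) : ℝ≥0∞) :=
    (measurable_from_nat (f := fun k => (m.choose k : ℝ≥0∞))).comp hk
  have hk' : Measurable fun z : (Fin m → X) × H => m - hitCount (Prod.mk z.2 ⁻¹' A) z.1 :=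
    (measurable_from_nat (f := fun k => m - k)).comp hk
  exact (hc.mul ((h1.pow hk).mul (h2.pow hk'))).inv

lemma lintegral_lintegral_invLikelihood_le (D : Measure X) [IsProbabilityMeasure D]
    (P : Measure H) [IsProbabilityMeasure P] {A : Set (H × X)} (hA : MeasurableSet A) :
    ∫⁻ S : Fin m → X, ∫⁻ h, invLikelihood D (Prod.mk h ⁻¹' A) S ∂P ∂Measure.pi (fun _ => D) ≤
      m + 1 := by
  rw [lintegral_lintegral_swap (measurable_invLikelihood D hA).aemeasurable]
  calc ∫⁻ h, ∫⁻ S : Fin m → X, invLikelihood D (Prod.mk h ⁻¹' A) S ∂Measure.pi (fun _ => D) ∂P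
      ≤ ∫⁻ _, (m + 1 : ℝ≥0∞) ∂P :=
        lintegral_mono fun h => lintegral_invLikelihood_le D (measurable_prodMk_left hA)
    _ = m + 1 := by simp

/-- The tilt `t = q (1 - p) / (p (1 - q))` attains the variational formula for `kl(q : p)`. -/
lemma tilt_eq_kl {q p : ℝ} (hq : 0 < q) (hqp : q ≤ p) (hp : p < 1) :
    q * Real.log (q * (1 - p) / (p * (1 - q))) -
      Real.log (1 - p * (1 - q * (1 - p) / (p * (1 - q)))) = klOneSided q p := by
  have hp0 : 0 < p := hq.trans_le hqp
  have hq1 : 0 < 1 - q := by linarith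
  have hp1 : 0 < 1 - p := by linarith
  rw [klOneSided, if_pos hqp, show 1 - p * (1 - q * (1 - p) / (p * (1 - q))) = (1 - p) / (1 - q) by
    field_simp; ring, Real.log_div (by positivity) (by positivity),
    Real.log_div (by positivity) (by positivity), Real.log_div (by positivity) (by positivity),
    Real.log_div (by positivity) (by positivity), Real.log_mul (by positivity) (by positivity),
    Real.log_mul (by positivity) (by positivity)]
  ring

/-- **PAC-Bayes-kl**, in the form that a single sample satisfies it for all posteriors. -/
lemma klOneSided_le_of_lintegral_invLikelihood_le (D : Measure X) [IsProbabilityMeasure D]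
    {P Q : Measure H} [IsProbabilityMeasure P] [IsProbabilityMeasure Q] {A : Set (H × X)}
    (hA : MeasurableSet A) {S : Fin m → X} {M : ℝ} (hM : 0 ≤ M)
    (hS : ∫⁻ h, invLikelihood D (Prod.mk h ⁻¹' A) S ∂P ≤ ENNReal.ofReal M)
    {c : ℝ} (hc : ChangeOfMeasure Q P c) {q p : ℝ} (hq : 0 < q) (hqp : q ≤ p) (hp : p < 1)
    (hemp : ∫ h, (hitCount (Prod.mk h ⁻¹' A) S : ℝ) ∂Q ≤ m * q)
    (htrue : p ≤ ∫ h, D.real (Prod.mk h ⁻¹' A) ∂Q) :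
    m * klOneSided q p ≤ c + Real.log M := by
  have hp0 : 0 < p := hq.trans_le hqp
  have hq1 : 0 < 1 - q := by linarith
  have hp1 : 0 < 1 - p := by linarith
  -- The optimal tilt depends on the posterior through `q` and `p`; this is legitimate because `hS`
  -- does not involve `t`. Since `t ≤ 1`, the inequalities `hemp` and `htrue` enter in the right
  -- direction.
  set t := q * (1 - p) / (p * (1 - q)) with ht
  have ht0 : 0 < t := by positivity
  have ht1 : t ≤ 1 := by
    rw [ht, div_le_one (by positivity)]; nlinarith
  have hlogt : Real.log t ≤ 0 := Real.log_nonpos ht0.le ht1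
  have hhit : Measurable fun h => (hitCount (Prod.mk h ⁻¹' A) S : ℝ) :=
    (measurable_from_nat (f := fun k => (k : ℝ))).comp
      ((measurable_hitCount (m := m) hA).comp (measurable_prodMk_left (x := S)))
  have hL : Measurable fun h => D.real (Prod.mk h ⁻¹' A) :=
    (measurable_measure_prodMk_left hA).ennreal_toReal
  have hL0 : ∀ h, 0 ≤ D.real (Prod.mk h ⁻¹' A) := fun h => measureReal_nonneg
  have hL1 : ∀ h, D.real (Prod.mk h ⁻¹' A) ≤ 1 := fun h => measureReal_le_one
  have hhitB : ∀ h, |(hitCount (Prod.mk h ⁻¹' A) S : ℝ)| ≤ m := fun h => by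
    rw [Nat.abs_cast]; exact_mod_cast hitCount_le _ _
  have hhiti : Integrable (fun h => (hitCount (Prod.mk h ⁻¹' A) S : ℝ)) Q :=
    integrable_of_abs_le hhit hhitB
  have hLi : Integrable (fun h => D.real (Prod.mk h ⁻¹' A)) Q :=
    integrable_of_abs_le hL (B := 1) fun h => by rw [abs_of_nonneg (hL0 h)]; exact hL1 h
  set y : H → ℝ := fun h => 1 - D.real (Prod.mk h ⁻¹' A) * (1 - t) with hy
  have hyt : ∀ h, t ≤ y h := fun h => by
    have := mul_le_mul_of_nonneg_right (hL1 h) (sub_nonneg.2 ht1)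
    simp only [hy]; linarith
  have hy1 : ∀ h, y h ≤ 1 := fun h => by
    have := mul_nonneg (hL0 h) (sub_nonneg.2 ht1)
    simp only [hy]; linarith
  have hym : Measurable y := by fun_prop
  have hlogyB : ∀ h, |Real.log (y h)| ≤ |Real.log t| := fun h => by
    rw [abs_of_nonpos hlogt, abs_of_nonpos (Real.log_nonpos (ht0.trans_le (hyt h)).le (hy1 h))]
    exact neg_le_neg (Real.log_le_log ht0 (hyt h))
  have hlogyi : Integrable (fun h => Real.log (y h)) Q := integrable_of_abs_le hym.log hlogyB
  set f : H → ℝ := fun h => hitCount (Prod.mk h ⁻¹' A) S * Real.log t - m * Real.log (y h) with hf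
  have hfm : Measurable f := (hhit.mul_const _).sub (hym.log.const_mul _)
  have hfB : ∀ h, |f h| ≤ m * |Real.log t| + m * |Real.log t| := fun h => by
    refine (abs_sub _ _).trans ?_
    rw [abs_mul, abs_mul, Nat.abs_cast, Nat.abs_cast]
    exact add_le_add
      (mul_le_mul_of_nonneg_right (by exact_mod_cast hitCount_le _ _) (abs_nonneg _))
      (mul_le_mul_of_nonneg_left (hlogyB h) (Nat.cast_nonneg m))
  have hexp : ∫ h, Real.exp (f h) ∂P ≤ M := by
    rw [← ENNReal.ofReal_le_ofReal_iff hM, ofReal_integral_eq_lintegral_ofReal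
      (integrable_exp_of_abs_le hfm hfB) (ae_of_all _ fun h => (Real.exp_pos _).le)]
    exact (lintegral_mono fun h => ofReal_exp_le_invLikelihood D
      (measurable_prodMk_left hA) S ht0).trans hS
  have hDV := hc f hfm ⟨_, hfB⟩
  have hlog := Real.log_le_log (integral_exp_pos_of_abs_le hfm hfB) hexp
  have hy0 : 0 < 1 - p * (1 - t) := by nlinarith
  -- Jensen for the concave logarithm, via its tangent line at `1 - p * (1 - t)`, which bounds the
  -- mean of `y` by `htrue`.
  have hJ : ∫ h, Real.log (y h) ∂Q ≤ Real.log (1 - p * (1 - t)) := by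
    have hpt : ∀ h, Real.log (y h) ≤
        Real.log (1 - p * (1 - t)) + (y h / (1 - p * (1 - t)) - 1) := fun h => by
      have := Real.log_le_sub_one_of_pos (div_pos (ht0.trans_le (hyt h)) hy0)
      rw [Real.log_div (ht0.trans_le (hyt h)).ne' hy0.ne'] at this
      linarith
    have hyi : Integrable y Q := (integrable_const _).sub (hLi.mul_const _)
    have hyint : ∫ h, y h ∂Q ≤ 1 - p * (1 - t) := by
      rw [hy, integral_sub (integrable_const _) (hLi.mul_const _), integral_mul_const]
      have := mul_le_mul_of_nonneg_right htrue (sub_nonneg.2 ht1)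
      simp only [integral_const, probReal_univ, one_smul]
      linarith
    have h2 := integral_mono hlogyi
      ((integrable_const _).add ((hyi.div_const _).sub (integrable_const _))) hpt
    rw [integral_add' (integrable_const _) ((hyi.div_const _).sub (integrable_const _)),
      integral_sub' (hyi.div_const _) (integrable_const _), integral_div] at h2
    have h3 := div_le_one_of_le₀ hyint hy0.le
    simp only [integral_const, probReal_univ, one_smul] at h2
    linarith
  have hfint : ∫ h, f h ∂Q = (∫ h, (hitCount (Prod.mk h ⁻¹' A) S : ℝ) ∂Q) * Real.log t -
      m * ∫ h, Real.log (y h) ∂Q := by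
    rw [hf, integral_sub (hhiti.mul_const _) (hlogyi.const_mul _), integral_mul_const,
      integral_const_mul]
  rw [← tilt_eq_kl hq hqp hp, ← ht]
  have h4 := mul_le_mul_of_nonpos_right hemp hlogt
  have h5 := mul_le_mul_of_nonneg_left hJ (Nat.cast_nonneg (α := ℝ) m)
  linarith

lemma integral_measureReal_preimage_swap (D : Measure X) [IsProbabilityMeasure D]
    (Q : Measure H) [IsProbabilityMeasure Q] {A : Set (H × X)} (hA : MeasurableSet A) :
    ∫ h, D.real (Prod.mk h ⁻¹' A) ∂Q = ∫ z, Q.real ((fun h => (h, z)) ⁻¹' A) ∂D := by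
  have hi : Integrable (Function.uncurry fun h z => A.indicator (1 : H × X → ℝ) (h, z))
      (Q.prod D) := (integrable_const (1 : ℝ)).indicator hA
  have h := integral_integral_swap hi
  have h1 : ∀ h, ∫ z, A.indicator (1 : H × X → ℝ) (h, z) ∂D = D.real (Prod.mk h ⁻¹' A) :=
    fun h => integral_indicator_one (measurable_prodMk_left hA)
  have h2 : ∀ z, ∫ h, A.indicator (1 : H × X → ℝ) (h, z) ∂Q =
      Q.real ((fun h => (h, z)) ⁻¹' A) :=
    fun z => integral_indicator_one (measurable_prodMk_right hA)
  simpa only [h1, h2] using h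

lemma integral_hitCount (Q : Measure H) [IsProbabilityMeasure Q] {A : Set (H × X)}
    (hA : MeasurableSet A) (S : Fin m → X) :
    ∫ h, (hitCount (Prod.mk h ⁻¹' A) S : ℝ) ∂Q = ∑ i, Q.real ((fun h => (h, S i)) ⁻¹' A) := by
  simp_rw [hitCount_eq_sum]
  rw [integral_finsetSum]
  · exact Finset.sum_congr rfl fun i _ => integral_indicator_one (measurable_prodMk_right hA)
  · exact fun i _ => (integrable_const (1 : ℝ)).indicator (measurable_prodMk_right hA)

/-- Hoeffding's inequality for the average of `T` independent draws. -/
lemma measureReal_average_sub_ge_le {Ω : Type*} [MeasurableSpace Ω] (Q : Measure Ω)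
    [IsProbabilityMeasure Q] {g : Ω → ℝ} (hg : Measurable g) (hg1 : ∀ ω, |g ω| ≤ 1) {T : ℕ}
    (hT : 0 < T) {ε : ℝ} (hε : 0 ≤ ε) :
    (Measure.pi fun _ : Fin T => Q).real {h | ε ≤ (∑ t, g (h t)) / T - ∫ ω, g ω ∂Q} ≤
      Real.exp (-(T * ε ^ 2 / 2)) := by
  have hT' : (0 : ℝ) < T := by exact_mod_cast hT
  have hind : iIndepFun (fun (t : Fin T) (h : Fin T → Ω) => g (h t) - ∫ ω, g ω ∂Q)
      (Measure.pi fun _ => Q) :=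
    iIndepFun_pi (X := fun _ ω => g ω - ∫ ω, g ω ∂Q) fun _ => by fun_prop
  have hsub : HasSubgaussianMGF (fun ω => g ω - ∫ ω, g ω ∂Q) 1 Q := by
    have := hasSubgaussianMGF_of_mem_Icc (μ := Q) (a := -1) (b := 1) hg.aemeasurable
      (ae_of_all _ fun ω => abs_le.1 (hg1 ω))
    convert this using 1
    norm_num
  have hsubt : ∀ t ∈ (Finset.univ : Finset (Fin T)),
      HasSubgaussianMGF (fun h : Fin T → Ω => g (h t) - ∫ ω, g ω ∂Q) 1 (Measure.pi fun _ => Q) :=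
    fun t _ => HasSubgaussianMGF.of_map (Y := fun h : Fin T → Ω => h t)
      (X := fun ω => g ω - ∫ ω, g ω ∂Q) (measurable_pi_apply t).aemeasurable
      (by rwa [(measurePreserving_eval (fun _ : Fin T => Q) t).map_eq])
  have h := HasSubgaussianMGF.measure_sum_ge_le_of_iIndepFun hind (c := fun _ => 1)
    (s := Finset.univ) hsubt (ε := T * ε) (by positivity)
  refine le_trans (measureReal_mono fun x hx => ?_) (h.trans (Real.exp_le_exp.2 (le_of_eq ?_)))
  · simp only [Set.mem_ofPred_eq, Finset.sum_sub_distrib, Finset.sum_const, Finset.card_univ,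
      Fintype.card_fin, nsmul_eq_mul] at hx ⊢
    have h1 := mul_le_mul_of_nonneg_left hx hT'.le
    rwa [mul_sub, mul_div_cancel₀ _ hT'.ne'] at h1
  · simp
    field_simp

end PACBayes

/-! ### From averaged random units to their mean -/

section Derandomisation

variable {X Ω : Type*} [MeasurableSpace X] [MeasurableSpace Ω]

/-- The number of draws at grid point `1 / n` and sample size `m`. -/
def drawCount (n m : ℕ) : ℕ := ⌈2 * (n : ℝ) ^ 2 * Real.log m⌉₊

/-- The pairs of `T` draws and an example at which the averaged margin is at most `1 / n`. -/
def lowMargin (g : Ω × X → ℝ) (n T : ℕ) : Set ((Fin T → Ω) × X) :=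
  {z | (∑ t, g (z.1 t, z.2)) / T ≤ 1 / (n : ℝ)}

lemma measurableSet_lowMargin {g : Ω × X → ℝ} (hg : Measurable g) (n T : ℕ) :
    MeasurableSet (lowMargin g n T) := by
  refine measurableSet_le ?_ measurable_const
  refine (Finset.measurable_sum _ fun t _ => hg.comp ?_).div_const _
  fun_prop

lemma exp_neg_drawCount_le {n m : ℕ} (hm : 0 < m) {ε : ℝ} (hn : 0 < n)
    (hε : 1 / (n : ℝ) ≤ ε) : Real.exp (-(drawCount n m * ε ^ 2 / 2)) ≤ 1 / m := by
  have hm' : (0 : ℝ) < m := by exact_mod_cast hm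
  have hn' : (0 : ℝ) < n := by exact_mod_cast hn
  rw [one_div, ← Real.exp_log hm', ← Real.exp_neg, Real.exp_le_exp, neg_le_neg_iff]
  have h1 : 2 * (n : ℝ) ^ 2 * Real.log m ≤ drawCount n m := Nat.le_ceil _
  have h2 : (1 / (n : ℝ)) ^ 2 ≤ ε ^ 2 := by gcongr
  have h0 : 0 ≤ Real.log m := Real.log_natCast_nonneg m
  calc Real.log m = 2 * (n : ℝ) ^ 2 * Real.log m * (1 / (n : ℝ)) ^ 2 / 2 := by field_simp
    _ ≤ drawCount n m * ε ^ 2 / 2 := by gcongr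

/-- If the mean margin at an example is nonpositive, an average above `1 / n` is a deviation of at
least `1 / n`, which has probability at most `1 / m`. -/
lemma error_sub_le_integral (D : Measure X) [IsProbabilityMeasure D] (Q : Measure Ω)
    [IsProbabilityMeasure Q] {g : Ω × X → ℝ} (hg : Measurable g) (hg1 : ∀ z, |g z| ≤ 1)
    {n m : ℕ} (hm : 0 < m) (hn : 0 < n) (hT : 0 < drawCount n m) :
    D.real {z | ∫ ω, g (ω, z) ∂Q ≤ 0} - 1 / m ≤
      ∫ h, D.real (Prod.mk h ⁻¹' lowMargin g n (drawCount n m)) ∂Measure.pi fun _ => Q := by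
  have hA := measurableSet_lowMargin hg n (drawCount n m)
  have hB : MeasurableSet {z | ∫ ω, g (ω, z) ∂Q ≤ 0} :=
    measurableSet_le hg.stronglyMeasurable.integral_prod_left'.measurable measurable_const
  rw [integral_measureReal_preimage_swap D _ hA]
  have hpt : ∀ z, {z | ∫ ω, g (ω, z) ∂Q ≤ 0}.indicator 1 z - 1 / (m : ℝ) ≤
      (Measure.pi fun _ => Q).real ((fun h => (h, z)) ⁻¹' lowMargin g n (drawCount n m)) := by
    intro z
    by_cases hz : z ∈ {z | ∫ ω, g (ω, z) ∂Q ≤ 0}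
    · have hgz : Measurable fun ω => g (ω, z) := by fun_prop
      have hHoef := (measureReal_average_sub_ge_le Q hgz (fun ω => hg1 _) hT
        (ε := 1 / (n : ℝ)) (by positivity)).trans (exp_neg_drawCount_le hm hn le_rfl)
      have hc := probReal_compl_eq_one_sub (μ := Measure.pi fun _ : Fin (drawCount n m) => Q)
        (measurable_prodMk_right (y := z) hA)
      have hsub : (Measure.pi fun _ => Q).real
          ((fun h => (h, z)) ⁻¹' lowMargin g n (drawCount n m))ᶜ ≤ 1 / m := by
        refine (measureReal_mono fun h hh => ?_).trans hHoef
        simp only [lowMargin, Set.mem_compl_iff, Set.mem_preimage, Set.mem_ofPred_eq, not_le]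
          at hh hz ⊢
        linarith
      rw [Set.indicator_of_mem hz, Pi.one_apply]
      linarith
    · rw [Set.indicator_of_notMem hz]
      have : (0 : ℝ) ≤ 1 / m := by positivity
      linarith [measureReal_nonneg (μ := Measure.pi fun _ => Q)
        (s := (fun h => (h, z)) ⁻¹' lowMargin g n (drawCount n m))]
  have hi1 : Integrable (fun z => {z | ∫ ω, g (ω, z) ∂Q ≤ 0}.indicator (1 : X → ℝ) z) D :=
    (integrable_const (1 : ℝ)).indicator hB
  have hi2 : Integrable (fun z => (Measure.pi fun _ => Q).real
      ((fun h => (h, z)) ⁻¹' lowMargin g n (drawCount n m))) D :=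
    integrable_of_abs_le (measurable_measure_prodMk_right hA).ennreal_toReal (B := 1) fun z => by
      rw [abs_of_nonneg measureReal_nonneg]; exact measureReal_le_one
  have := integral_mono (hi1.sub (integrable_const (1 / (m : ℝ)))) hi2 hpt
  rw [integral_sub' hi1 (integrable_const _), integral_indicator_one hB] at this
  simpa using this

/-- If the mean margin is at least `θ ≥ 2 / n`, an average of at most `1 / n` is a downward
deviation of at least `1 / n`. Each of the `m` sample points contributes at most `1 / m`, whence the
`+ 1`. -/
lemma integral_hitCount_lowMargin_le (Q : Measure Ω)
    [IsProbabilityMeasure Q] {g : Ω × X → ℝ} (hg : Measurable g) (hg1 : ∀ z, |g z| ≤ 1)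
    {n m : ℕ} (hm : 0 < m) (hn : 0 < n) (hT : 0 < drawCount n m) {θ : ℝ}
    (hθ : 2 / (n : ℝ) ≤ θ) (S : Fin m → X) :
    ∫ h, (hitCount (Prod.mk h ⁻¹' lowMargin g n (drawCount n m)) S : ℝ)
      ∂Measure.pi (fun _ => Q) ≤ hitCount {z | ∫ ω, g (ω, z) ∂Q < θ} S + 1 := by
  have hA := measurableSet_lowMargin hg n (drawCount n m)
  have hm' : (m : ℝ) ≠ 0 := by exact_mod_cast hm.ne'
  rw [integral_hitCount _ hA, hitCount_eq_sum]
  have h1 : ∑ _ : Fin m, 1 / (m : ℝ) = 1 := by simp [hm']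
  conv_rhs => rw [← h1]
  rw [← Finset.sum_add_distrib]
  refine Finset.sum_le_sum fun i _ => ?_
  by_cases hz : S i ∈ {z | ∫ ω, g (ω, z) ∂Q < θ}
  · rw [Set.indicator_of_mem hz, Pi.one_apply]
    have : (0 : ℝ) ≤ 1 / m := by positivity
    linarith [measureReal_le_one (μ := Measure.pi fun _ => Q)
      (s := (fun h => (h, S i)) ⁻¹' lowMargin g n (drawCount n m))]
  · rw [Set.indicator_of_notMem hz, zero_add]
    have hgz : Measurable fun ω => -g (ω, S i) := by fun_prop
    refine (measureReal_mono fun h hh => ?_).trans ((measureReal_average_sub_ge_le Q hgz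
      (fun ω => by rw [abs_neg]; exact hg1 _) hT (ε := 1 / (n : ℝ)) (by positivity)).trans
      (exp_neg_drawCount_le hm hn le_rfl))
    simp only [lowMargin, Set.mem_preimage, Set.mem_ofPred_eq, not_lt, Finset.sum_neg_distrib,
      integral_neg, neg_div, sub_neg_eq_add] at hh hz ⊢
    have : 2 / (n : ℝ) = 1 / n + 1 / n := by ring
    linarith

/-- The terms of the union bound are absorbed by the factor `32` in place of `18`. -/
lemma drawCount_mul_add_log_le {m n : ℕ} (hm : 2 ≤ m) {θ δ c : ℝ} (hθ : 0 < θ) (hθ1 : θ ≤ 1)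
    (hδ : 0 < δ) (hc : Real.log 2 ≤ c) (hn : (n : ℝ) * θ ≤ 3) :
    drawCount n m * c + Real.log ((m + 1) * 2 ^ (n + 1) / δ) ≤
      (32 * (1 / θ) ^ 2 * Real.log m + 1) * c +
        (Real.log (2 / δ) + 2 * Real.log (Real.logb 2 (4 / θ))) := by
  have hm' : (2 : ℝ) ≤ m := by exact_mod_cast hm
  have hl2 : 0.69 < Real.log 2 := by linarith [Real.log_two_gt_d9]
  have hlm : Real.log 2 ≤ Real.log m := Real.log_le_log (by norm_num) hm'
  set t := 1 / θ with ht
  have ht1 : 1 ≤ t := by rw [ht, le_div_iff₀ hθ]; linarith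
  have htt : t ≤ t ^ 2 := by nlinarith
  have hnt : (n : ℝ) ≤ 3 * t := by rw [ht, mul_one_div, le_div_iff₀ hθ]; exact hn
  -- The constant is `2 * 3 ^ 2`, from `n ≤ 3 / θ`.
  have hT : (drawCount n m : ℝ) ≤ 18 * t ^ 2 * Real.log m + 1 := by
    have h1 := (Nat.ceil_lt_add_one (a := 2 * (n : ℝ) ^ 2 * Real.log m) (by positivity)).le
    have h2 : (n : ℝ) ^ 2 ≤ (3 * t) ^ 2 := by gcongr
    have h3 := mul_le_mul_of_nonneg_right h2 (show 0 ≤ Real.log m by linarith)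
    rw [drawCount]
    linarith
  have hlogm1 : Real.log (m + 1) ≤ 2 * Real.log m := by
    have : Real.log ((m : ℝ) ^ 2) = 2 * Real.log m := by rw [Real.log_pow]; norm_num
    rw [← this]
    exact Real.log_le_log (by positivity) (by nlinarith)
  have hlog : Real.log ((m + 1) * 2 ^ (n + 1) / δ) =
      Real.log (m + 1) + n * Real.log 2 + Real.log (2 / δ) := by
    rw [Real.log_div (by positivity) hδ.ne', Real.log_mul (by positivity) (by positivity),
      Real.log_pow, Real.log_div (by norm_num) hδ.ne']
    push_cast; ring
  have hlb : 0 ≤ Real.log (Real.logb 2 (4 / θ)) := by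
    refine Real.log_nonneg ?_
    rw [Real.le_logb_iff_rpow_le (by norm_num) (by positivity), Real.rpow_one,
      le_div_iff₀ hθ]
    linarith
  rw [hlog]
  have hT2 := mul_le_mul_of_nonneg_right hT (show 0 ≤ c by linarith)
  have ha : 0 ≤ t ^ 2 * Real.log m := by positivity
  -- The slack `32 - 18 = 14`, with `c ≥ log 2`, exceeds `9 t² log m`, while `log (m + 1)` and `n
  -- log 2` need at most `2 + 3 = 5` such units. The iterated logarithm enters only through its
  -- nonnegativity.
  have h14 : 14 * (t ^ 2 * Real.log m) * 0.69 ≤ 14 * (t ^ 2 * Real.log m) * c :=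
    mul_le_mul_of_nonneg_left (by linarith) (by linarith)
  have hnl : (n : ℝ) * Real.log 2 ≤ 3 * (t ^ 2 * Real.log m) := by
    calc (n : ℝ) * Real.log 2 ≤ (3 * t ^ 2) * Real.log m :=
          mul_le_mul (by linarith) hlm (by linarith) (by positivity)
      _ = _ := by ring
  have hm2 : Real.log m ≤ t ^ 2 * Real.log m := by
    have : (1 : ℝ) ≤ t ^ 2 := by linarith
    nlinarith
  nlinarith

lemma exists_grid {θ : ℝ} (hθ : 0 < θ) (hθ1 : θ ≤ 1) :
    ∃ n : ℕ, 0 < n ∧ 2 / (n : ℝ) ≤ θ ∧ (n : ℝ) * θ ≤ 3 := by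
  have h1 := Nat.le_ceil (2 / θ)
  have h2 := Nat.ceil_lt_add_one (a := 2 / θ) (by positivity)
  have h0 : 0 < 2 / θ := by positivity
  have hn : (0 : ℝ) < ⌈2 / θ⌉₊ := h0.trans_le h1
  -- Rounding up gives `n * θ ≤ 2 + θ ≤ 3`.
  refine ⟨⌈2 / θ⌉₊, by exact_mod_cast hn, ?_, ?_⟩
  · rw [div_le_iff₀ hn, mul_comm]
    exact (div_le_iff₀ hθ).1 h1
  · have := mul_le_mul_of_nonneg_right h2.le hθ.le
    rw [add_mul, div_mul_cancel₀ _ hθ.ne'] at this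
    linarith

lemma klOneSided_of_lt {q p : ℝ} (h : p < q) : klOneSided q p = 0 := if_neg (not_le.2 h)

/-- The derandomised margin bound, simultaneously for all posteriors and margins. -/
theorem exists_event_klOneSided_le (D : Measure X) [IsProbabilityMeasure D] (P : Measure Ω)
    [IsProbabilityMeasure P] {g : Ω × X → ℝ} (hg : Measurable g) (hg1 : ∀ z, |g z| ≤ 1)
    {m : ℕ} (hm : 1 ≤ m) {δ : ℝ} (hδ : 0 < δ) (hδ1 : δ < 1) :
    ∃ E : Set (Fin m → X), MeasurableSet E ∧
      ENNReal.ofReal (1 - δ) ≤ Measure.pi (fun _ : Fin m => D) E ∧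
      ∀ S ∈ E, ∀ (Q : Measure Ω) [IsProbabilityMeasure Q] (c θ : ℝ), ChangeOfMeasure Q P c →
        Real.log 2 ≤ c → 0 < θ → θ ≤ 1 →
        klOneSided (hitCount {z | ∫ ω, g (ω, z) ∂Q < θ} S / m + 1 / m)
            (D.real {z | ∫ ω, g (ω, z) ∂Q ≤ 0} - 1 / m) ≤
          (32 * (1 / θ) ^ 2 * Real.log m + 1) / m * c +
            (Real.log (2 / δ) + 2 * Real.log (Real.logb 2 (4 / θ))) / m := by
  have hm0 : (0 : ℝ) < m := by exact_mod_cast hm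
  set A : (n : ℕ) → Set ((Fin (drawCount n m) → Ω) × X) :=
    fun n => lowMargin g n (drawCount n m) with hAdef
  have hA : ∀ n, MeasurableSet (A n) := fun n => measurableSet_lowMargin hg _ _
  set V : ℕ → (Fin m → X) → ℝ≥0∞ := fun n S =>
    ∫⁻ h, invLikelihood D (Prod.mk h ⁻¹' A n) S ∂Measure.pi fun _ => P with hV
  have hVm : ∀ n, Measurable (V n) := fun n =>
    (measurable_invLikelihood D (hA n)).lintegral_prod_right'
  set M : ℕ → ℝ := fun n => (m + 1) * 2 ^ (n + 1) / δ with hMdef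
  -- By Markov's inequality, grid point `n` fails with probability at most `δ / 2 ^ (n + 1)`; these
  -- sum to `δ`.
  have hM : ∀ n, 0 < M n := fun n => by positivity
  have hbad : ∀ n, Measure.pi (fun _ : Fin m => D) {S | ENNReal.ofReal (M n) < V n S} ≤
      ENNReal.ofReal (δ * (1 / 2) ^ (n + 1)) := fun n => by
    have h1 := mul_meas_ge_le_lintegral₀ (μ := Measure.pi (fun _ : Fin m => D))
      (hVm n).aemeasurable (ENNReal.ofReal (M n))
    have h2 := h1.trans (lintegral_lintegral_invLikelihood_le D _ (hA n))
    have h3 : (m + 1 : ℝ≥0∞) = ENNReal.ofReal (M n) * ENNReal.ofReal (δ * (1 / 2) ^ (n + 1)) := by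
      rw [← ENNReal.ofReal_mul (hM n).le]
      have : M n * (δ * (1 / 2) ^ (n + 1)) = m + 1 := by
        simp only [hMdef]
        rw [one_div, inv_pow]
        field_simp
      rw [this, ENNReal.ofReal_add hm0.le zero_le_one]
      simp
    rw [h3] at h2
    have h4 := (ENNReal.mul_le_mul_iff_right (by simpa using hM n) ENNReal.ofReal_ne_top).1 h2
    exact (measure_mono (Set.ofPred_subset_ofPred.2 fun S hS => hS.le)).trans h4
  have hbadm : ∀ n, MeasurableSet {S | ENNReal.ofReal (M n) < V n S} := fun n =>
    measurableSet_lt measurable_const (hVm n)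
  refine ⟨(⋃ n, {S | ENNReal.ofReal (M n) < V n S})ᶜ, (MeasurableSet.iUnion hbadm).compl, ?_, ?_⟩
  · rw [prob_compl_eq_one_sub (MeasurableSet.iUnion hbadm), ENNReal.ofReal_sub _ hδ.le,
      ENNReal.ofReal_one]
    refine tsub_le_tsub_left ?_ _
    have hs : HasSum (fun n : ℕ => δ * (1 / 2 : ℝ) ^ (n + 1)) δ := by
      have := (hasSum_geometric_two.mul_left (δ * (1 / 2)))
      rw [show δ * (1 / 2) * 2 = δ by ring] at this
      exact this.congr_fun fun n => by ring
    calc _ ≤ ∑' n, Measure.pi (fun _ : Fin m => D) {S | ENNReal.ofReal (M n) < V n S} :=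
          measure_iUnion_le _
      _ ≤ ∑' n : ℕ, ENNReal.ofReal (δ * (1 / 2) ^ (n + 1)) := ENNReal.tsum_le_tsum hbad
      _ = ENNReal.ofReal δ := by
          rw [← ENNReal.ofReal_tsum_of_nonneg (fun n => by positivity) hs.summable, hs.tsum_eq]
  · intro S hS Q _ c θ hc hc2 hθ hθ1
    have hl2 : 0 < Real.log 2 := Real.log_pos (by norm_num)
    have hlb : 0 ≤ Real.log (Real.logb 2 (4 / θ)) := by
      refine Real.log_nonneg ?_
      rw [Real.le_logb_iff_rpow_le (by norm_num) (by positivity), Real.rpow_one, le_div_iff₀ hθ]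
      linarith
    have hlogm : 0 ≤ Real.log m := Real.log_natCast_nonneg m
    have hld : 0 ≤ Real.log (2 / δ) := Real.log_nonneg (by rw [le_div_iff₀ hδ]; linarith)
    set q := (hitCount {z | ∫ ω, g (ω, z) ∂Q < θ} S : ℝ) / m + 1 / m with hq
    set p := D.real {z | ∫ ω, g (ω, z) ∂Q ≤ 0} - 1 / (m : ℝ) with hp
    have hq0 : 0 < q := by positivity
    have hp1 : p < 1 := by
      have : (0 : ℝ) < 1 / m := by positivity
      have := measureReal_le_one (μ := D) (s := {z | ∫ ω, g (ω, z) ∂Q ≤ 0})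
      linarith
    rcases lt_or_ge p q with h | hqp
    · rw [klOneSided_of_lt h]
      have : 0 ≤ c := by linarith
      positivity
    -- For `m = 1` the shifted error is at most `0 < q`, contradicting `hqp`. So `log m > 0` and at
    -- least one unit is drawn.
    have hm2 : 2 ≤ m := by
      by_contra hlt
      have : m = 1 := by omega
      rw [this] at hp
      have := measureReal_le_one (μ := D) (s := {z | ∫ ω, g (ω, z) ∂Q ≤ 0})
      norm_num at hp
      linarith
    obtain ⟨n, hn0, hnθ, hn3⟩ := exists_grid hθ hθ1
    have hT : 0 < drawCount n m := by
      have : 0 < Real.log m := Real.log_pos (by exact_mod_cast hm2)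
      have hn' : (0 : ℝ) < n := by exact_mod_cast hn0
      exact Nat.ceil_pos.2 (by positivity)
    have hSn : V n S ≤ ENNReal.ofReal (M n) := by
      simp only [Set.mem_compl_iff, Set.mem_iUnion, not_exists] at hS
      exact not_lt.1 (hS n)
    have hcT : ChangeOfMeasure (Measure.pi fun _ : Fin (drawCount n m) => Q)
        (Measure.pi fun _ => P) (drawCount n m * c) := by
      have := ChangeOfMeasure.pi (n := drawCount n m) fun _ => hc
      simpa using this
    have hemp := integral_hitCount_lowMargin_le Q hg hg1 hm hn0 hT hnθ S
    have hmain := klOneSided_le_of_lintegral_invLikelihood_le D (hA n) (hM n).le hSn hcT hq0 hqp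
      hp1 (by rw [hq, mul_add, mul_div_cancel₀ _ hm0.ne', mul_one_div_cancel hm0.ne']; exact hemp)
      (error_sub_le_integral D Q hg hg1 hm hn0 hT)
    have hnum := hmain.trans (drawCount_mul_add_log_le hm2 hθ hθ1 hδ hc2 hn3)
    rw [div_mul_eq_mul_div, ← add_div, le_div_iff₀ hm0, mul_comm]
    exact hnum

end Derandomisation

/-! ### The error function as a Gaussian mean of signs -/

section ErrorFunction

lemma measurable_realSign : Measurable Real.sign := by
  refine Measurable.ite measurableSet_Iio measurable_const ?_
  exact Measurable.ite measurableSet_Ioi measurable_const measurable_const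

lemma abs_realSign_le (x : ℝ) : |Real.sign x| ≤ 1 := by
  rcases Real.sign_apply_eq x with h | h | h <;> simp [h]

lemma sign_const_mul {c : ℝ} (hc : 0 < c) (x : ℝ) : Real.sign (c * x) = Real.sign x := by
  rcases lt_trichotomy x 0 with h | rfl | h
  · rw [Real.sign_of_neg h, Real.sign_of_neg (mul_neg_of_pos_of_neg hc h)]
  · rw [mul_zero]
  · rw [Real.sign_of_pos h, Real.sign_of_pos (mul_pos hc h)]

lemma integrable_exp_neg_sq : Integrable fun x : ℝ => Real.exp (-x ^ 2) := by
  simpa using integrable_exp_neg_mul_sq (b := 1) one_pos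

lemma integral_sign_add_mul_exp_neg_sq (b : ℝ) :
    ∫ x, Real.sign (x + b) * Real.exp (-x ^ 2) = 2 * ∫ t in (0 : ℝ)..b, Real.exp (-t ^ 2) := by
  have hint := integrable_exp_neg_sq
  have hi : Integrable fun x : ℝ => Real.sign (x + b) * Real.exp (-x ^ 2) :=
    hint.bdd_mul (c := 1)
      (measurable_realSign.comp (measurable_id.add_const b)).aestronglyMeasurable
      (ae_of_all _ fun x => abs_realSign_le _)
  rw [← setIntegral_univ, ← Set.Iic_union_Ioi (a := -b), setIntegral_union
    (Set.Iic_disjoint_Ioi le_rfl) measurableSet_Ioi hi.integrableOn hi.integrableOn]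
  have h1 : ∫ x in Set.Ioi (-b), Real.sign (x + b) * Real.exp (-x ^ 2) =
      ∫ x in Set.Iic b, Real.exp (-x ^ 2) := by
    rw [setIntegral_congr_fun (g := fun x => Real.exp (-x ^ 2)) measurableSet_Ioi fun x hx => ?_]
    · rw [← integral_comp_neg_Iic]; simp
    · have : 0 < x + b := by linarith [Set.mem_Ioi.1 hx]
      simp [Real.sign_of_pos this]
  have h2 : ∫ x in Set.Iic (-b), Real.sign (x + b) * Real.exp (-x ^ 2) =
      -∫ x in Set.Iic (-b), Real.exp (-x ^ 2) := by
    rw [integral_Iic_eq_integral_Iio, integral_Iic_eq_integral_Iio, ← integral_neg]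
    refine setIntegral_congr_fun measurableSet_Iio fun x hx => ?_
    have : x + b < 0 := by linarith [Set.mem_Iio.1 hx]
    simp [Real.sign_of_neg this]
  have h3 := intervalIntegral.integral_Iic_sub_Iic (a := -b) (b := b) hint.integrableOn
    hint.integrableOn
  have hii : ∀ a c : ℝ, IntervalIntegrable (fun x : ℝ => Real.exp (-x ^ 2)) volume a c :=
    fun a c => hint.intervalIntegrable
  have h4 := intervalIntegral.integral_add_adjacent_intervals (hii (-b) 0) (hii 0 b)
  have h5 : ∫ x in (-b)..0, Real.exp (-x ^ 2) = ∫ x in (0 : ℝ)..b, Real.exp (-x ^ 2) := by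
    have := intervalIntegral.integral_comp_neg (a := 0) (b := b) fun x : ℝ => Real.exp (-x ^ 2)
    simpa using this.symm
  linarith

lemma erf_eq_integral_sign (b : ℝ) : erf b = ∫ x, Real.sign (x + b) ∂gaussianReal 0 (1 / 2) := by
  rw [integral_gaussianReal_eq_integral_smul (by norm_num), erf, div_mul_eq_mul_div,
    ← integral_sign_add_mul_exp_neg_sq, ← integral_div]
  refine integral_congr_ae (ae_of_all _ fun x => ?_)
  simp [gaussianPDFReal, div_eq_mul_inv]
  ring_nf
  field_simp

lemma abs_erf_le (b : ℝ) : |erf b| ≤ 1 := by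
  rw [erf_eq_integral_sign]
  have := norm_integral_le_of_norm_le_const (μ := gaussianReal 0 (1 / 2))
    (f := fun x => Real.sign (x + b)) (ae_of_all _ fun x => abs_realSign_le _)
  simpa using this

lemma integral_sign_gaussianReal (a : ℝ) {s : ℝ} (hs : 0 < s) :
    ∫ x, Real.sign x ∂gaussianReal a (.mk (s ^ 2) (sq_nonneg s)) = erf (a / (√2 * s)) := by
  have h2 : (0 : ℝ) < √2 := by positivity
  have hmap : gaussianReal a (.mk (s ^ 2) (sq_nonneg s)) =
      (gaussianReal 0 (1 / 2)).map fun x => √2 * s * x + a := by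
    have h := gaussianReal_map_const_mul (μ := 0) (v := 1 / 2) (√2 * s)
    have h' := gaussianReal_map_add_const (μ := √2 * s * 0)
      (v := .mk ((√2 * s) ^ 2) (sq_nonneg _) * (1 / 2)) a
    rw [← h, Measure.map_map (by fun_prop) (by fun_prop)] at h'
    rw [show (fun x => √2 * s * x + a) = (fun x => x + a) ∘ fun x => √2 * s * x from rfl, h']
    congr 1
    · ring
    · ext
      simp [mul_pow]
      ring
  rw [hmap, integral_map (by fun_prop) measurable_realSign.aestronglyMeasurable,
    erf_eq_integral_sign]
  refine integral_congr_ae (ae_of_all _ fun x => ?_)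
  have : √2 * s * x + a = √2 * s * (x + a / (√2 * s)) := by field_simp
  simp only [this]
  exact sign_const_mul (by positivity) _

end ErrorFunction

/-! ### Gaussian weight vectors and their projections -/

section GaussianLaw

variable {d : ℕ}

/-- The law of a Gaussian vector with mean `a` and identity covariance. -/
def hiddenLaw (a : Input d) : Measure (Fin d → ℝ) := Measure.pi fun i => gaussianReal (a i) 1

instance (a : Input d) : IsProbabilityMeasure (hiddenLaw a) := by
  unfold hiddenLaw; infer_instance

lemma measurable_sum_mul (x : Input d) : Measurable fun w : Fin d → ℝ => ∑ i, w i * x i := by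
  fun_prop

/-- Characteristic functions: independence of the coordinates turns the transform into a product of
one-dimensional Gaussian ones. -/
lemma hiddenLaw_map_sum_mul (a x : Input d) :
    (hiddenLaw a).map (fun w => ∑ i, w i * x i) =
      gaussianReal (inner ℝ a x) (.mk (‖x‖ ^ 2) (sq_nonneg _)) := by
  have : IsProbabilityMeasure ((hiddenLaw a).map fun w => ∑ i, w i * x i) :=
    Measure.isProbabilityMeasure_map (measurable_sum_mul x).aemeasurable
  refine Measure.ext_of_charFun ?_
  ext t
  rw [charFun_gaussianReal, charFun_apply_real, integral_map (measurable_sum_mul x).aemeasurable (by fun_prop)]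
  have h : ∀ w : Fin d → ℝ, Complex.exp (t * ((∑ i, w i * x i : ℝ) : ℂ) * Complex.I) =
      ∏ i, Complex.exp (((t * x i : ℝ) : ℂ) * w i * Complex.I) := fun w => by
    rw [← Complex.exp_sum]
    congr 1
    push_cast
    rw [Finset.mul_sum, Finset.sum_mul]
    exact Finset.sum_congr rfl fun i _ => by ring
  simp_rw [h]
  rw [hiddenLaw, integral_fintype_prod_eq_prod
    (f := fun i (y : ℝ) => Complex.exp (((t * x i : ℝ) : ℂ) * y * Complex.I))]
  simp_rw [← charFun_apply_real, charFun_gaussianReal]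
  rw [← Complex.exp_sum]
  congr 1
  rw [Finset.sum_sub_distrib, PiLp.inner_apply]
  simp only [NNReal.coe_mk, EuclideanSpace.real_norm_sq_eq]
  push_cast
  rw [Finset.mul_sum, Finset.sum_mul, Finset.sum_mul, Finset.sum_div]
  congr 1
  · exact Finset.sum_congr rfl fun i _ => by simp; ring
  · exact Finset.sum_congr rfl fun i _ => by simp; ring

lemma integral_sign_hiddenLaw (a x : Input d) :
    ∫ w, Real.sign (∑ i, w i * x i) ∂hiddenLaw a = erf (inner ℝ a x / (√2 * ‖x‖)) := by
  rcases eq_or_ne x 0 with rfl | hx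
  -- At `x = 0` both sides vanish: `Real.sign 0 = 0`, and division by zero gives `erf 0 = 0`.
  · simp [erf]
  · rw [← integral_sign_gaussianReal _ (norm_pos_iff.2 hx), ← hiddenLaw_map_sum_mul,
      integral_map (measurable_sum_mul x).aemeasurable
        measurable_realSign.aestronglyMeasurable]

lemma changeOfMeasure_hiddenLaw (a b : Input d) :
    ChangeOfMeasure (hiddenLaw a) (hiddenLaw b) (‖a - b‖ ^ 2 / 2) := by
  have := ChangeOfMeasure.pi fun i => changeOfMeasure_gaussianReal (a i) (b i)
  rw [EuclideanSpace.real_norm_sq_eq, Finset.sum_div]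
  exact this

end GaussianLaw

/-! ### The mixture posterior, its prior and its complexity -/

section Posterior

variable {K d : ℕ}

lemma l1Norm_nonneg (v : Fin K → ℝ) : 0 ≤ l1Norm v := Finset.sum_nonneg fun _ _ => abs_nonneg _

lemma mixWeight_nonneg (v : Fin K → ℝ) (k : Fin K) : 0 ≤ mixWeight v k :=
  div_nonneg (abs_nonneg _) (l1Norm_nonneg v)

lemma sum_mixWeight {v : Fin K → ℝ} (hv : 0 < l1Norm v) : ∑ k, mixWeight v k = 1 := by
  simp only [mixWeight]
  rw [← Finset.sum_div]
  exact div_self hv.ne'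

/-- The weights of the hidden unit `k` with output sign `b` in the mixture. -/
def signedWeight (v : Fin K → ℝ) (j : Fin K × Bool) : ℝ :=
  if j.2 = decide (0 ≤ v j.1) then mixWeight v j.1 else 0

lemma signedWeight_nonneg (v : Fin K → ℝ) (j : Fin K × Bool) : 0 ≤ signedWeight v j := by
  unfold signedWeight
  split_ifs
  exacts [mixWeight_nonneg v _, le_rfl]

/-- For each `k` only the sign of `v k` carries weight, so doubling the indices adds no entropy;
`hf` removes the other sign. -/
lemma sum_signedWeight_mul (v : Fin K → ℝ) (f : Fin K → Bool → ℝ → ℝ)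
    (hf : ∀ k b, f k b 0 = 0) :
    ∑ j, f j.1 j.2 (signedWeight v j) = ∑ k, f k (decide (0 ≤ v k)) (mixWeight v k) := by
  rw [Fintype.sum_prod_type]
  refine Finset.sum_congr rfl fun k _ => ?_
  rw [Fintype.sum_bool]
  by_cases h : 0 ≤ v k <;> simp [signedWeight, h, hf]

/-- Signed hidden units: an index, an output sign, and a hidden weight vector. -/
abbrev Unit (K d : ℕ) : Type := (Fin K × Bool) × (Fin d → ℝ)

/-- The posterior of a network on signed hidden units. -/
def posterior (v : Fin K → ℝ) (u : Fin K → Input d) : Measure (Unit K d) :=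
  mixture (signedWeight v) fun j => hiddenLaw (u j.1)

/-- The prior on signed hidden units. -/
def prior (u₀ : Fin K → Input d) : Measure (Unit K d) :=
  mixture (fun _ => 1 / (2 * (K : ℝ))) fun j => hiddenLaw (u₀ j.1)

lemma isProbabilityMeasure_posterior {v : Fin K → ℝ} (hv : 0 < l1Norm v) (u : Fin K → Input d) :
    IsProbabilityMeasure (posterior v u) :=
  isProbabilityMeasure_mixture (signedWeight_nonneg v)
    ((sum_signedWeight_mul v (fun _ _ t => t) fun _ _ => rfl).trans (sum_mixWeight hv)) _

lemma isProbabilityMeasure_prior (hK : 0 < K) (u₀ : Fin K → Input d) :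
    IsProbabilityMeasure (prior u₀) := by
  have hK' : (K : ℝ) ≠ 0 := by exact_mod_cast hK.ne'
  refine isProbabilityMeasure_mixture (fun _ => by positivity) ?_ _
  simp
  field_simp

lemma changeOfMeasure_posterior_prior (hK : 0 < K) {v : Fin K → ℝ} (hv : 0 < l1Norm v)
    (u u₀ : Fin K → Input d) :
    ChangeOfMeasure (posterior v u) (prior u₀) (complexity v u u₀) := by
  have : Nonempty (Fin K) := ⟨⟨0, hK⟩⟩
  have hK' : (0 : ℝ) < K := by exact_mod_cast hK
  have h := ChangeOfMeasure.mixture (signedWeight_nonneg v)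
    ((sum_signedWeight_mul v (fun _ _ t => t) fun _ _ => rfl).trans (sum_mixWeight hv))
    (r := fun _ => 1 / (2 * (K : ℝ))) (fun _ => by positivity)
    fun j => changeOfMeasure_hiddenLaw (u j.1) (u₀ j.1)
  rw [sum_signedWeight_mul v (fun k _ t => t * (Real.log (t / (1 / (2 * (K : ℝ)))) +
    ‖u k - u₀ k‖ ^ 2 / 2)) (by simp)] at h
  have hterm : ∀ k, mixWeight v k * (Real.log (mixWeight v k / (1 / (2 * (K : ℝ)))) +
      ‖u k - u₀ k‖ ^ 2 / 2) = mixWeight v k * Real.log (2 * K) - (mixWeight v k).negMulLog +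
        1 / 2 * (mixWeight v k * ‖u k - u₀ k‖ ^ 2) := fun k => by
    rcases eq_or_ne (mixWeight v k) 0 with h0 | h0
    · simp [h0]
    · rw [div_div_eq_mul_div, div_one, Real.log_mul h0 (by positivity), Real.negMulLog]
      ring
  rw [Finset.sum_congr rfl fun k _ => hterm k, Finset.sum_add_distrib, Finset.sum_sub_distrib,
    ← Finset.sum_mul, sum_mixWeight hv, ← Finset.mul_sum, one_mul] at h
  exact h

/-- The margin of a single signed hidden unit. -/
def unitMargin (z : Unit K d × (Input d × Label)) : ℝ :=
  (z.2.2 : ℝ) * ((if z.1.1.2 = true then 1 else -1) * Real.sign (∑ i, z.1.2 i * z.2.1 i))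

lemma measurable_unitMargin : Measurable (unitMargin (K := K) (d := d)) := by
  refine (measurable_subtype_coe.comp (measurable_snd.comp measurable_snd)).mul
    (Measurable.mul ?_ (measurable_realSign.comp ?_))
  · refine Measurable.ite ?_ measurable_const measurable_const
    exact (show Measurable fun z : Unit K d × (Input d × Label) => z.1.1.2 by fun_prop)
      (measurableSet_singleton true)
  · fun_prop

lemma abs_label (y : Label) : |(y : ℝ)| = 1 := by
  rcases y.2 with h | h <;> simp [h]

lemma abs_unitMargin_le (z : Unit K d × (Input d × Label)) : |unitMargin z| ≤ 1 := by
  rw [unitMargin, abs_mul, abs_mul, abs_label, one_mul]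
  split_ifs <;> simpa using abs_realSign_le _

lemma integral_unitMargin (v : Fin K → ℝ) (u : Fin K → Input d) (z : Input d × Label) :
    ∫ ω, unitMargin (ω, z) ∂posterior v u = margin (network v u) z / l1Norm v := by
  have hm : Measurable fun ω : Unit K d => unitMargin (ω, z) :=
    measurable_unitMargin.comp measurable_prodMk_right
  rw [posterior, integral_mixture (signedWeight_nonneg v) _ hm fun ω => abs_unitMargin_le _]
  simp only [unitMargin]
  have hsign : ∀ j : Fin K × Bool, ∫ w, (z.2 : ℝ) * ((if j.2 = true then 1 else -1) *
      Real.sign (∑ i, w i * z.1 i)) ∂hiddenLaw (u j.1) = (z.2 : ℝ) *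
        ((if j.2 = true then 1 else -1) * erf (inner ℝ (u j.1) z.1 / (√2 * ‖z.1‖))) := fun j => by
    rw [integral_const_mul, integral_const_mul, integral_sign_hiddenLaw]
  simp_rw [hsign]
  rw [sum_signedWeight_mul v (fun k b t => t * ((z.2 : ℝ) * ((if b = true then 1 else -1) *
    erf (inner ℝ (u k) z.1 / (√2 * ‖z.1‖))))) (by simp), margin, network, Finset.mul_sum,
    Finset.sum_div]
  refine Finset.sum_congr rfl fun k _ => ?_
  by_cases h : 0 ≤ v k
  · simp only [mixWeight, h, abs_of_nonneg h, decide_true, if_true]; ring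
  · simp only [mixWeight, h, abs_of_neg (not_le.1 h), decide_false, Bool.false_eq_true, if_false]
    ring

lemma entropy_nonneg {v : Fin K → ℝ} (hv : 0 < l1Norm v) : 0 ≤ entropy (mixWeight v) := by
  refine Finset.sum_nonneg fun k _ => Real.negMulLog_nonneg (mixWeight_nonneg v k) ?_
  rw [← sum_mixWeight hv]
  exact Finset.single_le_sum (fun j _ => mixWeight_nonneg v j) (Finset.mem_univ k)

lemma entropy_le_log (hK : 0 < K) {v : Fin K → ℝ} (hv : 0 < l1Norm v) :
    entropy (mixWeight v) ≤ Real.log K := by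
  have hK' : (0 : ℝ) < K := by exact_mod_cast hK
  have hterm : ∀ k, (mixWeight v k).negMulLog ≤
      mixWeight v k * Real.log K + (1 / (K : ℝ) - mixWeight v k) := fun k => by
    rcases (mixWeight_nonneg v k).eq_or_lt with h0 | h0
    · rw [← h0]; simp
    · have h := Real.log_le_sub_one_of_pos (x := 1 / (K * mixWeight v k)) (by positivity)
      rw [one_div, Real.log_inv, Real.log_mul hK'.ne' h0.ne'] at h
      have h2 := mul_le_mul_of_nonneg_left h h0.le
      have h3 : mixWeight v k * ((K * mixWeight v k)⁻¹ - 1) = 1 / (K : ℝ) - mixWeight v k := by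
        field_simp
      rw [h3] at h2
      rw [Real.negMulLog]
      linarith
  have := Finset.sum_le_sum fun k (_ : k ∈ Finset.univ) => hterm k
  rw [Finset.sum_add_distrib, Finset.sum_sub_distrib, ← Finset.sum_mul, sum_mixWeight hv] at this
  simpa [entropy, hK'.ne'] using this

/-- The entropy is at most `log K`. This lower bound is what lets the complexity term absorb the
cost of the union bound. -/
lemma log_two_le_complexity (hK : 0 < K) {v : Fin K → ℝ} (hv : 0 < l1Norm v)
    (u u₀ : Fin K → Input d) : Real.log 2 ≤ complexity v u u₀ := by
  have hK' : (K : ℝ) ≠ 0 := by exact_mod_cast hK.ne'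
  have h1 := entropy_le_log hK hv
  have h2 : 0 ≤ ∑ k, mixWeight v k * ‖u k - u₀ k‖ ^ 2 :=
    Finset.sum_nonneg fun k _ => mul_nonneg (mixWeight_nonneg v k) (sq_nonneg _)
  rw [complexity, Real.log_mul two_ne_zero hK']
  linarith

end Posterior

/-! ### From the kl bound to the square-root bound -/

section SquareRootBound

variable {K d m : ℕ}

lemma empMarginError_eq (S : Fin m → Input d × Label) (γ : ℝ) (f : Input d → ℝ) :
    empMarginError S γ f = hitCount {z | margin f z < γ} S / m := rfl

lemma margin_network_le (v : Fin K → ℝ) (u : Fin K → Input d) (z : Input d × Label) :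
    margin (network v u) z ≤ l1Norm v := by
  refine (le_abs_self _).trans ?_
  rw [margin, abs_mul, abs_label, one_mul, network]
  refine (Finset.abs_sum_le_sum_abs _ _).trans (Finset.sum_le_sum fun k _ => ?_)
  rw [abs_mul]
  exact mul_le_of_le_one_right (abs_nonneg _) (abs_erf_le _)

lemma empMarginError_eq_one (hm : 1 ≤ m) {v : Fin K → ℝ} {γ : ℝ} (hγ : l1Norm v < γ)
    (u : Fin K → Input d) (S : Fin m → Input d × Label) :
    empMarginError S γ (network v u) = 1 := by
  have hm' : (m : ℝ) ≠ 0 := by exact_mod_cast (Nat.pos_of_ne_zero (by omega)).ne'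
  have : ∀ i, margin (network v u) (S i) < γ := fun i => (margin_network_le v u _).trans_lt hγ
  simp [empMarginError, this, hm']

/-- A Pinsker-type inequality, by comparison with the Hellinger distance. -/
lemma sq_sub_div_four_le_klOneSided {q p : ℝ} (hq : 0 < q) (hqp : q ≤ p) (hp : p < 1) :
    (p - q) ^ 2 / 4 ≤ klOneSided q p := by
  have key : ∀ x y : ℝ, 0 < x → 0 < y → 2 * (x - √x * √y) ≤ x * Real.log (x / y) := by
    intro x y hx hy
    have hsx := Real.sqrt_pos.2 hx
    have hsy := Real.sqrt_pos.2 hy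
    have h := Real.log_le_sub_one_of_pos (div_pos hsy hsx)
    rw [Real.log_div hsy.ne' hsx.ne', Real.log_sqrt hx.le, Real.log_sqrt hy.le] at h
    have h2 := mul_le_mul_of_nonneg_left h hx.le
    have h3 : x * (√y / √x - 1) = √x * √y - x := by
      rw [mul_sub, mul_one, mul_div_assoc', div_eq_iff hsx.ne' |>.2]
      rw [mul_right_comm, Real.mul_self_sqrt hx.le]
    rw [Real.log_div hx.ne' hy.ne']
    linarith
  have hp0 : 0 < p := hq.trans_le hqp
  rw [klOneSided, if_pos hqp]
  have h1 := key q p hq hp0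
  have h2 := key (1 - q) (1 - p) (by linarith) (by linarith)
  have ha := Real.sq_sqrt hq.le
  have hb := Real.sq_sqrt hp0.le
  have hc := Real.sq_sqrt (show 0 ≤ 1 - q by linarith)
  have he := Real.sq_sqrt (show 0 ≤ 1 - p by linarith)
  have hb1 : √p ≤ 1 := Real.sqrt_le_one.2 hp.le
  have ha1 : √q ≤ 1 := Real.sqrt_le_one.2 (hqp.trans hp.le)
  have ha0 := Real.sqrt_nonneg q
  have hb0 := Real.sqrt_nonneg p
  have hdiff : (p - q) ^ 2 = (√p - √q) ^ 2 * (√p + √q) ^ 2 := by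
    nth_rw 1 [← hb]
    nth_rw 1 [← ha]
    ring
  -- Adding `h1` and `h2` bounds the divergence below by the squared Hellinger distance, of which
  -- only the first square is kept; here `√p + √q ≤ 2`.
  have hle : (p - q) ^ 2 ≤ (√p - √q) ^ 2 * 4 := by
    rw [hdiff]
    exact mul_le_mul_of_nonneg_left (by nlinarith) (sq_nonneg _)
  nlinarith [sq_nonneg (√(1 - q) - √(1 - p))]

/-- The deviation is at most `√(4 * 49 * R) = 14 √R`, and the two shifts by `1 / m` cost at most `3
√R` by `hR`; `20` leaves room to spare. -/
lemma le_add_sqrt_of_klOneSided_le {q₀ L B R : ℝ} (hm : 1 ≤ m) (hq : 0 ≤ q₀) (hL : L ≤ 1)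
    (hkl : klOneSided (q₀ + 1 / m) (L - 1 / m) ≤ B) (hB : B ≤ 49 * R) (hR : 4 / 9 / m ≤ R) :
    L ≤ q₀ + 20 * √R := by
  have hm0 : (0 : ℝ) < m := by exact_mod_cast hm
  have hm1 : (1 : ℝ) ≤ m := by exact_mod_cast hm
  have him : (0 : ℝ) < 1 / m := by positivity
  have him1 : 1 / (m : ℝ) ≤ 1 := by rw [div_le_one hm0]; exact hm1
  have hR0 : 0 ≤ R := le_trans (by positivity) hR
  have h1 : 2 / (m : ℝ) ≤ 3 * √R := by
    rw [← div_le_iff₀' (by norm_num)]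
    refine Real.le_sqrt_of_sq_le (le_trans (le_of_eq_of_le ?_
      (mul_le_mul_of_nonneg_left him1 (show 0 ≤ 4 / 9 / (m : ℝ) by positivity))) ?_)
    · field_simp; norm_num
    · rw [mul_one]; exact hR
  have h2m : 2 / (m : ℝ) = 1 / m + 1 / m := by ring
  have hs := Real.sqrt_nonneg R
  rcases lt_or_ge (L - 1 / m) (q₀ + 1 / m) with h | h
  · linarith
  · have hP := sq_sub_div_four_le_klOneSided (by linarith) h (by linarith)
    have h3 : (L - 1 / m - (q₀ + 1 / m)) ≤ 14 * √R := by
      refine abs_le_of_sq_le_sq' ?_ (by positivity) |>.2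
      rw [mul_pow, Real.sq_sqrt hR0]
      linarith
    linarith

lemma kl_bound_le_sqrt_argument (hK : 0 < K) (hm : 1 ≤ m) {v : Fin K → ℝ} {γ δ : ℝ} (hγ : 0 < γ)
    (hγv : γ ≤ l1Norm v) (hδ : 0 < δ) (hδ1 : δ < 1) (u u₀ : Fin K → Input d) :
    (32 * (l1Norm v / γ) ^ 2 * Real.log m + 1) / m * complexity v u u₀ +
        (Real.log (2 / δ) + 2 * Real.log (Real.logb 2 (4 * l1Norm v / γ))) / m ≤
      49 * (l1Norm v * Real.log (2 * m) / (m * γ ^ 2) *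
        (∑ k, |v k| * (‖u k - u₀ k‖ ^ 2 + Real.log (2 * K))) + Real.log (1 / δ) / m) ∧
    4 / 9 / m ≤ l1Norm v * Real.log (2 * m) / (m * γ ^ 2) *
        (∑ k, |v k| * (‖u k - u₀ k‖ ^ 2 + Real.log (2 * K))) + Real.log (1 / δ) / m := by
  have hv : 0 < l1Norm v := hγ.trans_le hγv
  have hm0 : (0 : ℝ) < m := by exact_mod_cast hm
  have hm1 : (1 : ℝ) ≤ m := by exact_mod_cast hm
  have hK1 : (1 : ℝ) ≤ K := by exact_mod_cast hK
  have hl2 : 2 / 3 < Real.log 2 := by linarith [Real.log_two_gt_d9]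
  set Y := ∑ k, mixWeight v k * (‖u k - u₀ k‖ ^ 2 + Real.log (2 * K)) with hY
  set t := l1Norm v / γ with ht
  have hR : l1Norm v * Real.log (2 * m) / (m * γ ^ 2) *
      (∑ k, |v k| * (‖u k - u₀ k‖ ^ 2 + Real.log (2 * K))) + Real.log (1 / δ) / m =
      (t ^ 2 * Real.log (2 * m) * Y + Real.log (1 / δ)) / m := by
    have : ∑ k, |v k| * (‖u k - u₀ k‖ ^ 2 + Real.log (2 * K)) = l1Norm v * Y := by
      rw [hY, Finset.mul_sum]
      refine Finset.sum_congr rfl fun k _ => ?_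
      rw [mixWeight]; field_simp
    rw [this, ht]; field_simp
  have hY2 : Y = ∑ k, mixWeight v k * ‖u k - u₀ k‖ ^ 2 + Real.log (2 * K) := by
    simp only [hY, mul_add]
    rw [Finset.sum_add_distrib, ← Finset.sum_mul, sum_mixWeight hv, one_mul]
  have hs0 : 0 ≤ ∑ k, mixWeight v k * ‖u k - u₀ k‖ ^ 2 :=
    Finset.sum_nonneg fun k _ => mul_nonneg (mixWeight_nonneg v k) (sq_nonneg _)
  have hcY : complexity v u u₀ ≤ Y := by
    rw [hY2, complexity]
    linarith [entropy_nonneg hv]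
  have hYl : 2 / 3 ≤ Y := by
    have : Real.log 2 ≤ Real.log (2 * K) := Real.log_le_log (by norm_num) (by linarith)
    linarith
  have hlm : Real.log (2 * m) = Real.log 2 + Real.log m := Real.log_mul two_ne_zero hm0.ne'
  have hlm0 : 0 ≤ Real.log m := Real.log_nonneg hm1
  have ht1 : 1 ≤ t := by rw [ht, one_le_div hγ]; exact hγv
  have htt : t ≤ t ^ 2 := by nlinarith
  have hld : 0 ≤ Real.log (1 / δ) := Real.log_nonneg (by rw [le_div_iff₀ hδ]; linarith)
  have hl2d : Real.log (2 / δ) = Real.log 2 + Real.log (1 / δ) := by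
    rw [← Real.log_mul two_ne_zero (by positivity)]; congr 1; ring
  -- Two uses of `log s ≤ s - 1`, with `1 / log 2 ≤ 3 / 2`.
  have hll : Real.log (Real.logb 2 (4 * l1Norm v / γ)) ≤ 3 / 2 * t := by
    have h4 : Real.logb 2 (4 * l1Norm v / γ) = 2 + Real.log t / Real.log 2 := by
      rw [mul_div_assoc, ← ht, Real.logb, Real.log_mul (by norm_num) (by positivity),
        show (4 : ℝ) = 2 ^ 2 by norm_num, Real.log_pow]
      have : Real.log 2 ≠ 0 := by linarith
      field_simp
      push_cast
      ring
    have hlt : 0 ≤ Real.log t := Real.log_nonneg ht1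
    have hpos : 0 ≤ Real.log t / Real.log 2 := div_nonneg hlt (by linarith)
    have h5 : Real.log t / Real.log 2 ≤ 3 / 2 * (t - 1) := by
      rw [div_le_iff₀ (by linarith)]
      have := Real.log_le_sub_one_of_pos (show 0 < t by linarith)
      nlinarith
    rw [h4]
    have := Real.log_le_sub_one_of_pos (show 0 < 2 + Real.log t / Real.log 2 by linarith)
    linarith
  set Z := t ^ 2 * Real.log (2 * m) with hZ
  have hl2m : 2 / 3 ≤ Real.log (2 * m) := by linarith
  have hZt : 2 / 3 * t ^ 2 ≤ Z := by
    rw [hZ, mul_comm]; exact mul_le_mul_of_nonneg_left hl2m (sq_nonneg _)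
  have hZ1 : 2 / 3 ≤ Z := by linarith
  -- As `Z` and `Y` are both at least `2 / 3`, every lower-order term is a multiple of `Z * Y`: the
  -- total is at most `32 + 3/2 + 9/4 + 27/4 < 49` of it. The product of the two bounds is the `4 /
  -- 9` of the second claim.
  have hZY : 2 / 3 * Z ≤ Z * Y := by nlinarith
  have hYZ : 2 / 3 * Y ≤ Z * Y := by nlinarith
  rw [hR]
  constructor
  · rw [div_mul_eq_mul_div, ← add_div, ← mul_div_assoc]
    refine div_le_div_of_nonneg_right ?_ hm0.le
    have hcoef : 32 * t ^ 2 * Real.log m + 1 ≤ 32 * Z + 1 := by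
      have : t ^ 2 * Real.log m ≤ Z := mul_le_mul_of_nonneg_left (by linarith) (sq_nonneg _)
      linarith
    have h6 : (32 * t ^ 2 * Real.log m + 1) * complexity v u u₀ ≤ (32 * Z + 1) * Y :=
      (mul_le_mul_of_nonneg_left hcY (by positivity)).trans
        (mul_le_mul_of_nonneg_right hcoef (by linarith))
    rw [hl2d]
    have hl1 : Real.log 2 ≤ 1 := by linarith [Real.log_two_lt_d9]
    linarith
  · refine div_le_div_of_nonneg_right ?_ hm0.le
    linarith

end SquareRootBound

end SHEL

end

/-! ### Assembly of the two bounds -/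

theorem mainTheorem7 :
    ∃ C : ℝ, 0 < C ∧
      ∀ (K d m : ℕ), 1 ≤ m →
      ∀ (D : Measure (SHEL.Input d × SHEL.Label)) [IsProbabilityMeasure D]
        (u₀ : Fin K → SHEL.Input d) (γ δ : ℝ), 0 < γ → 0 < δ → δ < 1 →
      ∃ E : Set (Fin m → SHEL.Input d × SHEL.Label),
        MeasurableSet E ∧
        ENNReal.ofReal (1 - δ) ≤ Measure.pi (fun _ : Fin m => D) E ∧
        ∀ S ∈ E, ∀ (v : Fin K → ℝ) (u : Fin K → SHEL.Input d),
          (SHEL.error D (SHEL.network v u) ≤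
            SHEL.empMarginError S γ (SHEL.network v u) +
              C * Real.sqrt
                (SHEL.l1Norm v * Real.log (2 * m) / (m * γ ^ 2) *
                    (∑ k, |v k| * (‖u k - u₀ k‖ ^ 2 + Real.log (2 * K))) +
                  Real.log (1 / δ) / m)) ∧
          (γ ≤ SHEL.l1Norm v →
            SHEL.klOneSided
                (SHEL.empMarginError S γ (SHEL.network v u) + 1 / m)
                (SHEL.error D (SHEL.network v u) - 1 / m) ≤
              (32 * (SHEL.l1Norm v / γ) ^ 2 * Real.log m + 1) / m * SHEL.complexity v u u₀ +
                (Real.log (2 / δ) + 2 * Real.log (Real.logb 2 (4 * SHEL.l1Norm v / γ))) / m) := by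
  refine ⟨20, by norm_num, fun K d m hm D _ u₀ γ δ hγ hδ hδ1 => ?_⟩
  -- When `l1Norm v < γ` no margin reaches `γ`, so the empirical error is `1` and the bound is
  -- trivial. This also covers `v = 0` and `K = 0`, where there is no posterior.
  have hlarge : ∀ (S : Fin m → SHEL.Input d × SHEL.Label) (v : Fin K → ℝ)
      (u : Fin K → SHEL.Input d) (R : ℝ), SHEL.l1Norm v < γ →
      SHEL.error D (SHEL.network v u) ≤ SHEL.empMarginError S γ (SHEL.network v u) + 20 * √R := by
    intro S v u R h
    rw [SHEL.empMarginError_eq_one hm h]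
    have : SHEL.error D (SHEL.network v u) ≤ 1 := measureReal_le_one
    have := Real.sqrt_nonneg R
    linarith
  rcases Nat.eq_zero_or_pos K with rfl | hK
  · have hl : ∀ v : Fin 0 → ℝ, SHEL.l1Norm v < γ := fun v => by simpa [SHEL.l1Norm] using hγ
    refine ⟨Set.univ, MeasurableSet.univ, ?_, fun S _ v u =>
      ⟨hlarge S v u _ (hl v), fun h => absurd h (not_le.2 (hl v))⟩⟩
    rw [measure_univ, ENNReal.ofReal_le_one]
    linarith
  · have := SHEL.isProbabilityMeasure_prior hK u₀
    obtain ⟨E, hE, hDE, hmain⟩ := SHEL.exists_event_klOneSided_le D (SHEL.prior u₀)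
      SHEL.measurable_unitMargin SHEL.abs_unitMargin_le hm hδ hδ1
    refine ⟨E, hE, hDE, fun S hS v u => ?_⟩
    have hkl : γ ≤ SHEL.l1Norm v → SHEL.klOneSided
        (SHEL.empMarginError S γ (SHEL.network v u) + 1 / m)
        (SHEL.error D (SHEL.network v u) - 1 / m) ≤
        (32 * (SHEL.l1Norm v / γ) ^ 2 * Real.log m + 1) / m * SHEL.complexity v u u₀ +
          (Real.log (2 / δ) + 2 * Real.log (Real.logb 2 (4 * SHEL.l1Norm v / γ))) / m := by
      intro hγv
      have hv := hγ.trans_le hγv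
      have := SHEL.isProbabilityMeasure_posterior hv u
      -- Dividing margins by `l1Norm v` turns `γ` into `θ = γ / l1Norm v`, which is at most `1`.
      have h := hmain S hS (SHEL.posterior v u) (SHEL.complexity v u u₀) (γ / SHEL.l1Norm v)
        (SHEL.changeOfMeasure_posterior_prior hK hv u u₀) (SHEL.log_two_le_complexity hK hv u u₀)
        (div_pos hγ hv) ((div_le_one hv).2 hγv)
      simp only [SHEL.integral_unitMargin, div_lt_div_iff_of_pos_right hv, 
        div_le_iff₀ hv, zero_mul, div_div_eq_mul_div, one_mul] at h
      exact h
    refine ⟨?_, hkl⟩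
    rcases lt_or_ge (SHEL.l1Norm v) γ with h | h
    · exact hlarge S v u _ h
    · obtain ⟨h1, h2⟩ := SHEL.kl_bound_le_sqrt_argument hK hm hγ h hδ hδ1 u u₀
      exact SHEL.le_add_sqrt_of_klOneSided_le hm (by rw [SHEL.empMarginError_eq]; positivity)
        measureReal_le_one (hkl h) h1 h2
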